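/- Let $(M,g)$ be a spacetime, i.e. a connected (Hausdorff, second countable) smooth manifold of dimension at least $3$ with a smooth time-oriented Lorentzian metric $g$ and Levi-Civita connection $\nabla$. Let $L\subset M$ be a null hypersurface, i.e. an embedded codimension-one submanifold on which the induced metric tensor is degenerate at every point. A null section of $L$ is a smooth nowhere-zero vector field $\xi\in\mathfrak X(L)$ that is everywhere null; its surface gravity is the function $\kappa_\xi:L\to\mathbb R$ with $\nabla_\xi\xi=\kappa_\xi\,\xi$. For $x\in L$ let $(b^-_\xi(x),b^+_\xi(x))\subseteq\mathbb R$ be the maximal interval on which the integral curve of $\xi$ in $L$ starting at $x$ is defined. Let $\Lambda^+_\xi(x)\in(0,+\infty]$ be the supremum of the $s>0$ such that $\exp(r\xi_x)$ is defined and lies in $L$ for all $0\le r<s$, and let $\Lambda^-_\xi(x)\in[-\infty,0)$ be the infimum of the $s<0$ such that $\exp(r\xi_x)$ is defined and lies in $L$ for all $s<r\le 0$. Let $\xi$ be a null section of $L$, let $x_0\in L$, and let $\gamma$ be the maximal integral curve of $\xi$ with $\gamma(0)=x_0$. Suppose that $b^+_\xi(x_0)=+\infty$ and $b^-_\xi(x_0)=-\infty$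 (so that $\gamma$ is defined on all of $\mathbb R$), that $\kappa_\xi(\gamma(t))\ge 0$ for all $t\ge 0$, and that $\kappa_\xi(\gamma(t))\le 0$ for all $t\le 0$. Then $L$ admits no null section $\eta$ whose surface gravity $\kappa_\eta$ is a nonzero constant. Moreover, the null geodesic generator of $L$ through $x_0$ is complete: there is a null geodesic of $M$ defined on all of $\mathbb R$ that stays in $L$ and is at $x_0$ at time $0$, and $\Lambda^+_\xi(x_0)=+\infty$, $\Lambda^-_\xi(x_0)=-\infty$. -/

import Mathlib

open Set Bundle
open scoped Manifold ContDiff Topology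

noncomputable section

section Spacetime

/-- The data making a manifold `M` (modelled on the finite-dimensional space `E`) into a spacetime:
a smooth Lorentzian metric (signature `-,+,…,+`) and a smooth timelike vector field, which fixes
the time orientation. -/
structure SpacetimeStructure (E : Type*) [NormedAddCommGroup E] [NormedSpace ℝ E]
    (M : Type*) [TopologicalSpace M] [ChartedSpace E M] [IsManifold 𝓘(ℝ, E) ∞ M] where
  /-- the metric tensor -/
  metric (p : M) : TangentSpace 𝓘(ℝ, E) p →L[ℝ] TangentSpace 𝓘(ℝ, E) p →L[ℝ] ℝ
  symm (p : M) (v w : TangentSpace 𝓘(ℝ, E) p) : metric p v w = metric p w v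
  /-- Lorentzian signature: some line is negative and its orthogonal complement is positive. -/
  lorentzian (p : M) : ∃ e : TangentSpace 𝓘(ℝ, E) p, metric p e e < 0 ∧
    ∀ w : TangentSpace 𝓘(ℝ, E) p, metric p e w = 0 → w ≠ 0 → 0 < metric p w w
  contMDiff_metric : ContMDiff 𝓘(ℝ, E) (𝓘(ℝ, E).prod 𝓘(ℝ, E →L[ℝ] E →L[ℝ] ℝ)) ∞
    (fun p ↦ TotalSpace.mk' (E →L[ℝ] E →L[ℝ] ℝ)
      (E := fun q : M ↦ TangentSpace 𝓘(ℝ, E) q →L[ℝ] TangentSpace 𝓘(ℝ, E) q →L[ℝ] ℝ) p (metric p))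
  /-- the vector field giving the time orientation -/
  timeField (p : M) : TangentSpace 𝓘(ℝ, E) p
  contMDiff_timeField : ContMDiff 𝓘(ℝ, E) 𝓘(ℝ, E).tangent ∞
    (fun p ↦ (⟨p, timeField p⟩ : TangentBundle 𝓘(ℝ, E) M))
  timelike_timeField (p : M) : metric p (timeField p) (timeField p) < 0

variable {E : Type*} [NormedAddCommGroup E] [NormedSpace ℝ E]
  {M : Type*} [TopologicalSpace M] [ChartedSpace E M]

/-- The velocity `c'(t)` of a curve. -/
def velocity (c : ℝ → M) (t : ℝ) : TangentSpace 𝓘(ℝ, E) (c t) :=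
  mfderiv 𝓘(ℝ, ℝ) 𝓘(ℝ, E) c t (1 : ℝ)

variable [IsManifold 𝓘(ℝ, E) ∞ M]

namespace SpacetimeStructure

/-- The metric in the preferred chart `φ` at `p`, as a function of the coordinates `y`:
`(v, w) ↦ g(dφ⁻¹ v, dφ⁻¹ w)` at the point `φ⁻¹ y`. -/
def chartMetric (g : SpacetimeStructure E M) (p : M) (y : E) : E →L[ℝ] E →L[ℝ] ℝ :=
  let q : M := (extChartAt 𝓘(ℝ, E) p).symm y
  let A : E →L[ℝ] TangentSpace 𝓘(ℝ, E) q :=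
    (trivializationAt E (TangentSpace 𝓘(ℝ, E)) p).symmL ℝ q
  (ContinuousLinearMap.precomp ℝ A).comp ((g.metric q).comp A)

variable [FiniteDimensional ℝ E] (g : SpacetimeStructure E M)

/-- The metric is nondegenerate: `v ↦ g(v, ·)` is a bijection from tangent to cotangent vectors. -/
theorem flat_bijective (p : M) : Function.Bijective (g.metric p).toLinearMap := by
  have hinj : Function.Injective (g.metric p).toLinearMap := by
    rw [injective_iff_map_eq_zero]
    intro w hw
    have hw' : ∀ z, g.metric p w z = 0 := fun z ↦ by
      have := congrArg (fun f : TangentSpace 𝓘(ℝ, E) p →L[ℝ] ℝ ↦ f z) hw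
      simpa using this
    obtain ⟨e, -, he⟩ := g.lorentzian p
    by_contra h0
    have := he w (by rw [g.symm, hw']) h0
    rw [hw'] at this
    exact lt_irrefl _ this
  have e : (E →L[ℝ] ℝ) ≃ₗ[ℝ] Module.Dual ℝ E :=
    (LinearMap.toContinuousLinearMap (𝕜 := ℝ) (E := E) (F' := ℝ)).symm
  have : FiniteDimensional ℝ (E →L[ℝ] ℝ) := e.symm.finiteDimensional
  have hd : Module.finrank ℝ E = Module.finrank ℝ (E →L[ℝ] ℝ) := by
    rw [e.finrank_eq, Subspace.dual_finrank_eq]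
  exact ⟨hinj, (LinearMap.injective_iff_surjective_of_finrank_eq_finrank
    (V := E) (V₂ := E →L[ℝ] ℝ) hd).1 hinj⟩

/-- Raising an index: `g.sharp p α` is the vector `v` with `g(v, ·) = α`. -/
def sharp (p : M) : (TangentSpace 𝓘(ℝ, E) p →L[ℝ] ℝ) →ₗ[ℝ] TangentSpace 𝓘(ℝ, E) p :=
  (LinearEquiv.ofBijective (g.metric p).toLinearMap (g.flat_bijective p)).symm.toLinearMap

set_option synthInstance.maxHeartbeats 400000 in
/-- The Christoffel symbols of the Levi-Civita connection at `p` in the preferred chart at `p`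
(which identifies `T_p M` with the model space): `Γ(u, v)` is the vector with
`g(Γ(u, v), z) = (∂_u g(v, z) + ∂_v g(u, z) - ∂_z g(u, v)) / 2` for all `z`. -/
def christoffel (p : M) (u v : E) : TangentSpace 𝓘(ℝ, E) p :=
  let D : E →L[ℝ] E →L[ℝ] E →L[ℝ] ℝ := fderiv ℝ (g.chartMetric p) (extChartAt 𝓘(ℝ, E) p p)
  g.sharp p ((1 / 2 : ℝ) • (D u v + D v u - (D.flip u).flip v) : E →L[ℝ] ℝ)

/-- The Levi-Civita covariant derivative `∇_u V` at `x`, in the direction `u ∈ T_x N`, of a vector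
field `V` along a map `F : N → M` (that is, `V y ∈ T_{F y} M`). In the preferred chart of `M` at
`F x` it is `dV(u) + Γ(dF(u), V)`. -/
def covDerivAlong {E' : Type*} [NormedAddCommGroup E'] [NormedSpace ℝ E']
    {N : Type*} [TopologicalSpace N] [ChartedSpace E' N]
    (F : N → M) (V : (y : N) → TangentSpace 𝓘(ℝ, E) (F y)) (x : N) (u : TangentSpace 𝓘(ℝ, E') x) :
    TangentSpace 𝓘(ℝ, E) (F x) :=
  let V' : N → E := fun y ↦ (trivializationAt E (TangentSpace 𝓘(ℝ, E)) (F x) ⟨F y, V y⟩).2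
  let dV : E := mfderiv 𝓘(ℝ, E') 𝓘(ℝ, E) V' x u
  let dF : E := mfderiv 𝓘(ℝ, E') 𝓘(ℝ, E) F x u
  (show TangentSpace 𝓘(ℝ, E) (F x) from dV) + g.christoffel (F x) dF (V x)

/-- `c` is a geodesic of the Levi-Civita connection on the open set `J` of parameters:
it is smooth there and `∇_{c'} c' = 0`. -/
def IsGeodesicOn (c : ℝ → M) (J : Set ℝ) : Prop :=
  ContMDiffOn 𝓘(ℝ, ℝ) 𝓘(ℝ, E) ∞ c J ∧
    ∀ t ∈ J, g.covDerivAlong (E' := ℝ) c (velocity c) t (1 : ℝ) = 0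

/-- The graph of the exponential map `exp : 𝒟 ⊆ TM → M`: `g.HasExp v q` says that `v ∈ 𝒟` and
`exp v = q`, i.e. that the geodesic with initial velocity `v` is defined on an open interval
containing `[0, 1]` and is at `q` at time `1`. -/
def HasExp (v : TangentBundle 𝓘(ℝ, E) M) (q : M) : Prop :=
  ∃ (c : ℝ → M) (J : Set ℝ), IsOpen J ∧ J.OrdConnected ∧ Icc 0 1 ⊆ J ∧ g.IsGeodesicOn c J ∧
    (⟨c 0, velocity c 0⟩ : TangentBundle 𝓘(ℝ, E) M) = v ∧ c 1 = q

end SpacetimeStructure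

end Spacetime

section NullHypersurface

variable {E : Type*} [NormedAddCommGroup E] [NormedSpace ℝ E] [FiniteDimensional ℝ E]
  {M : Type*} [TopologicalSpace M] [ChartedSpace E M] [IsManifold 𝓘(ℝ, E) ∞ M]
  {E' : Type*} [NormedAddCommGroup E'] [NormedSpace ℝ E']
  {L : Type*} [TopologicalSpace L] [ChartedSpace E' L]

/-- The image in `T_{i x} M` of a vector `v` tangent to `L` at `x`. -/
def pushVector (i : L → M) {x : L} (v : TangentSpace 𝓘(ℝ, E') x) : TangentSpace 𝓘(ℝ, E) (i x) :=
  mfderiv 𝓘(ℝ, E') 𝓘(ℝ, E) i x v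

/-- `i : L → M` is a (codimension-one, embedded) null hypersurface: a smooth embedding whose induced
metric tensor is degenerate at every point. -/
structure IsNullHypersurface (g : SpacetimeStructure E M) (i : L → M) : Prop where
  isSmoothEmbedding : Manifold.IsSmoothEmbedding 𝓘(ℝ, E') 𝓘(ℝ, E) ∞ i
  codim_one : Module.finrank ℝ E = Module.finrank ℝ E' + 1
  degenerate (x : L) : ∃ v : TangentSpace 𝓘(ℝ, E') x, v ≠ 0 ∧
    ∀ w : TangentSpace 𝓘(ℝ, E') x, g.metric (i x) (pushVector i v) (pushVector i w) = 0

/-- A null section of `L`: a smooth tangent vector field, nowhere zero and everywhere null. -/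
structure IsNullSection [IsManifold 𝓘(ℝ, E') ∞ L] (g : SpacetimeStructure E M) (i : L → M)
    (ξ : (x : L) → TangentSpace 𝓘(ℝ, E') x) : Prop where
  contMDiff : ContMDiff 𝓘(ℝ, E') 𝓘(ℝ, E').tangent ∞ (fun x ↦ (⟨x, ξ x⟩ : TangentBundle 𝓘(ℝ, E') L))
  ne_zero (x : L) : ξ x ≠ 0
  null (x : L) : g.metric (i x) (pushVector i (ξ x)) (pushVector i (ξ x)) = 0

open Classical in
/-- The surface gravity `κ_ξ` of a null section `ξ`: the number with `∇_ξ ξ = κ_ξ ξ` at `x`. -/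
def surfaceGravity (g : SpacetimeStructure E M) (i : L → M)
    (ξ : (x : L) → TangentSpace 𝓘(ℝ, E') x) (x : L) : ℝ :=
  if h : ∃ k : ℝ, g.covDerivAlong i (fun y ↦ pushVector i (ξ y)) x (ξ x) = k • pushVector i (ξ x)
  then h.choose else 0

/-- The maximal domain `𝒜_ξ` of the flow of `ξ`: the pairs `(x, t)` such that the integral curve
of `ξ` starting at `x` is defined on an open interval containing `0` and `t`. -/
def flowDomain (ξ : (x : L) → TangentSpace 𝓘(ℝ, E') x) : Set (L × ℝ) :=
  {a | ∃ (c : ℝ → L) (J : Set ℝ), IsOpen J ∧ J.OrdConnected ∧ 0 ∈ J ∧ a.2 ∈ J ∧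
    c 0 = a.1 ∧ IsMIntegralCurveOn c ξ J}

/-- The final parameter `b⁺_ξ(x) = sup {t > 0 : {x} × [0, t) ⊆ 𝒜_ξ}`. -/
def finalParameter (ξ : (x : L) → TangentSpace 𝓘(ℝ, E') x) (x : L) : EReal :=
  sSup {T : EReal | ∃ t : ℝ, 0 < t ∧ ({x} ×ˢ Ico 0 t ⊆ flowDomain ξ) ∧ T = t}

/-- The initial parameter `b⁻_ξ(x) = inf {t < 0 : {x} × (t, 0] ⊆ 𝒜_ξ}`. -/
def initialParameter (ξ : (x : L) → TangentSpace 𝓘(ℝ, E') x) (x : L) : EReal :=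
  sInf {T : EReal | ∃ t : ℝ, t < 0 ∧ ({x} ×ˢ Ioc t 0 ⊆ flowDomain ξ) ∧ T = t}

/-- The set `ℬ_ξ` of pairs `(x, s)` such that `exp (s ξ_x)` is defined and lies in `L`. -/
def affineDomain (g : SpacetimeStructure E M) (i : L → M)
    (ξ : (x : L) → TangentSpace 𝓘(ℝ, E') x) : Set (L × ℝ) :=
  {a | ∃ y : L, g.HasExp ⟨i a.1, a.2 • pushVector i (ξ a.1)⟩ (i y)}

/-- The future affine length `Λ⁺_ξ(x) = sup {s > 0 : {x} × [0, s) ⊆ ℬ_ξ}`. -/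
def futureAffineLength (g : SpacetimeStructure E M) (i : L → M)
    (ξ : (x : L) → TangentSpace 𝓘(ℝ, E') x) (x : L) : EReal :=
  sSup {S : EReal | ∃ s : ℝ, 0 < s ∧ ({x} ×ˢ Ico 0 s ⊆ affineDomain g i ξ) ∧ S = s}

/-- The past affine length `Λ⁻_ξ(x) = inf {s < 0 : {x} × (s, 0] ⊆ ℬ_ξ}`. -/
def pastAffineLength (g : SpacetimeStructure E M) (i : L → M)
    (ξ : (x : L) → TangentSpace 𝓘(ℝ, E') x) (x : L) : EReal :=
  sInf {S : EReal | ∃ s : ℝ, s < 0 ∧ ({x} ×ˢ Ioc s 0 ⊆ affineDomain g i ξ) ∧ S = s}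

/-- The null geodesic generator of `L` through `x` is complete: there is a null geodesic of `M`,
parametrized by all of `ℝ`, that runs inside `L` and is at `x` at time `0`. -/
def HasCompleteNullGenerator (E' : Type*) [NormedAddCommGroup E'] [NormedSpace ℝ E']
    {L : Type*} [TopologicalSpace L] [ChartedSpace E' L]
    (g : SpacetimeStructure E M) (i : L → M) (x : L) : Prop :=
  ∃ c : ℝ → L, ContMDiff 𝓘(ℝ, ℝ) 𝓘(ℝ, E') ∞ c ∧ c 0 = x ∧ g.IsGeodesicOn (i ∘ c) univ ∧
    ∀ t, velocity (E := E) (i ∘ c) t ≠ 0 ∧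
      g.metric (i (c t)) (velocity (i ∘ c) t) (velocity (i ∘ c) t) = 0

end NullHypersurface

end

/-! A null section of `L` spans the degenerate direction of the induced metric, so it is both
tangent and normal to `L`. Differentiating the normality relation shows that `∇_ξ ξ` is normal to
`L` as well, hence a multiple of `ξ` because the codimension is one (`exists_covDeriv_eq_smul`). The
whole statement then reduces to ordinary differential equations along `γ`. Write `κ` for the surface
gravity of `ξ` along `γ`.

Completeness: `γ ∘ τ` is a geodesic of `M` when `τ'' = -κ(τ) τ'²`, that is, when `τ` is inverse to
`S(t) = ∫₀ᵗ exp K` with `K(t) = ∫₀ᵗ κ`. The two sign conditions give `K ≥ 0` on both half-lines, so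
`S' ≥ 1`. Hence `S` maps the line onto itself and the affine parameter runs over all of `ℝ`
(`exists_affine_parameter`).

Obstruction: any other null section is `η = f ξ` along `γ` with `f` nowhere zero. If its surface
gravity is the constant `c`, then `c f ξ = ∇_η η = f (f' + f κ) ξ`, so `f' = c - κ f`. For `c > 0`
the sign conditions force a positive `f` to reach zero in the past, and a negative `f` to reach zero
in the future; `c < 0` follows by passing to `-f` (`exists_eq_zero_of_deriv`).

The connection is defined at each point through the preferred chart there, which changes along a
curve. Smoothness of `κ` along `γ` therefore needs the covariant derivative in one fixed chart
(`form_covDerivAlong`), which rests on the transformation law `christoffelLower_pullback`. -/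

set_option synthInstance.maxHeartbeats 400000

/-! ### Christoffel symbols of a metric on a vector space. -/

section FlatCalculus

variable {E F : Type*} [NormedAddCommGroup E] [NormedSpace ℝ E]
  [NormedAddCommGroup F] [NormedSpace ℝ F]

theorem differentiableAt_comp_bilinear {G : E → E →L[ℝ] E →L[ℝ] ℝ} {f : F → E} {u : F}
    (hG : DifferentiableAt ℝ G (f u)) (hf : DifferentiableAt ℝ f u) :
    DifferentiableAt ℝ (fun x ↦ G (f x)) u :=
  DifferentiableAt.fun_comp' (G := E →L[ℝ] E →L[ℝ] ℝ) (g := G) u hG hf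

theorem fderiv_comp_bilinear_apply {G : E → E →L[ℝ] E →L[ℝ] ℝ} {f : F → E} {u : F}
    (hG : DifferentiableAt ℝ G (f u)) (hf : DifferentiableAt ℝ f u) (b : F) :
    fderiv ℝ (fun x ↦ G (f x)) u b = fderiv ℝ G (f u) (fderiv ℝ f u b) :=
  congrArg (fun T ↦ T b) (fderiv_comp (G := E →L[ℝ] E →L[ℝ] ℝ) (g := G) u hG hf)

theorem fderiv_bilinear_apply {B : F → E →L[ℝ] E →L[ℝ] ℝ} {P Q : F → E} {u : F}
    (hB : DifferentiableAt ℝ B u) (hP : DifferentiableAt ℝ P u) (hQ : DifferentiableAt ℝ Q u)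
    (a : F) :
    fderiv ℝ (fun x ↦ B x (P x) (Q x)) u a = fderiv ℝ B u a (P u) (Q u) +
      B u (fderiv ℝ P u a) (Q u) + B u (P u) (fderiv ℝ Q u a) := by
  have h := (hB.hasFDerivAt.clm_apply hP.hasFDerivAt).clm_apply hQ.hasFDerivAt
  rw [h.fderiv]
  simp only [add_apply, ContinuousLinearMap.comp_apply,
    ContinuousLinearMap.flip_apply]
  ring

/-- The Christoffel symbols of the first kind of a metric `G` on a vector space. -/
noncomputable def christoffelLower (G : E → E →L[ℝ] E →L[ℝ] ℝ) (y u v z : E) : ℝ :=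
  (1 / 2 : ℝ) * (fderiv ℝ G y u v z + fderiv ℝ G y v u z - fderiv ℝ G y z u v)

theorem contDiffAt_comp_bilinear {G : E → E →L[ℝ] E →L[ℝ] ℝ} {f : F → E} {u : F} {n : WithTop ℕ∞}
    (hG : ContDiffAt ℝ n G (f u)) (hf : ContDiffAt ℝ n f u) :
    ContDiffAt ℝ n (fun x ↦ G (f x)) u :=
  ContDiffAt.comp (G := E →L[ℝ] E →L[ℝ] ℝ) (g := G) u hG hf

set_option maxSynthPendingDepth 6 in
theorem contDiffAt_christoffelLower {G : E → E →L[ℝ] E →L[ℝ] ℝ} {f P Q R : F → E} {u : F}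
    (hG : ContDiffAt ℝ ∞ G (f u)) (hf : ContDiffAt ℝ ∞ f u) (hP : ContDiffAt ℝ ∞ P u)
    (hQ : ContDiffAt ℝ ∞ Q u) (hR : ContDiffAt ℝ ∞ R u) :
    ContDiffAt ℝ ∞ (fun x ↦ christoffelLower G (f x) (P x) (Q x) (R x)) u := by
  have hD : ContDiffAt ℝ ∞ (fun x ↦ fderiv ℝ G (f x)) u :=
    ContDiffAt.comp (G := E →L[ℝ] E →L[ℝ] E →L[ℝ] ℝ) (g := fderiv ℝ G) u
      (hG.fderiv_right (m := ∞) (by simp)) hf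
  exact contDiffAt_const.mul
    (((((hD.clm_apply hP).clm_apply hQ).clm_apply hR).add
      (((hD.clm_apply hQ).clm_apply hP).clm_apply hR)).sub
      (((hD.clm_apply hR).clm_apply hP).clm_apply hQ))

/-- Transformation law of the Christoffel symbols of the first kind under a change of
coordinates. -/
theorem christoffelLower_pullback {G₁ G₂ : E → E →L[ℝ] E →L[ℝ] ℝ} {ψ : E → E} {y : E}
    (hG₁ : DifferentiableAt ℝ G₁ y) (hG₂ : DifferentiableAt ℝ G₂ (ψ y))
    (hψ : ContDiffAt ℝ 2 ψ y) (hsymm : ∀ v w, G₂ (ψ y) v w = G₂ (ψ y) w v)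
    (hG : ∀ v w, (fun x ↦ G₁ x v w) =ᶠ[𝓝 y] fun x ↦ G₂ (ψ x) (fderiv ℝ ψ x v) (fderiv ℝ ψ x w))
    (u v z : E) :
    christoffelLower G₁ y u v z =
      christoffelLower G₂ (ψ y) (fderiv ℝ ψ y u) (fderiv ℝ ψ y v) (fderiv ℝ ψ y z) +
      G₂ (ψ y) (fderiv ℝ (fderiv ℝ ψ) y u v) (fderiv ℝ ψ y z) := by
  have hψ1 : DifferentiableAt ℝ ψ y := hψ.differentiableAt (by norm_num)
  have hψ2 : DifferentiableAt ℝ (fderiv ℝ ψ) y :=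
    (hψ.fderiv_right (m := 1) (by norm_num)).differentiableAt (by norm_num)
  have hsym2 (a b : E) : fderiv ℝ (fderiv ℝ ψ) y a b = fderiv ℝ (fderiv ℝ ψ) y b a :=
    (hψ.isSymmSndFDerivAt (by simp)).eq a b
  have hev (a v : E) : fderiv ℝ (fun x ↦ fderiv ℝ ψ x v) y a = fderiv ℝ (fderiv ℝ ψ) y a v := by
    rw [(hψ2.hasFDerivAt.clm_apply (hasFDerivAt_const v y)).fderiv]; simp
  have hev' (v : E) : DifferentiableAt ℝ (fun x ↦ fderiv ℝ ψ x v) y :=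
    hψ2.clm_apply (differentiableAt_const v)
  have key (a v w : E) : fderiv ℝ G₁ y a v w =
      fderiv ℝ G₂ (ψ y) (fderiv ℝ ψ y a) (fderiv ℝ ψ y v) (fderiv ℝ ψ y w) +
      G₂ (ψ y) (fderiv ℝ (fderiv ℝ ψ) y a v) (fderiv ℝ ψ y w) +
      G₂ (ψ y) (fderiv ℝ ψ y v) (fderiv ℝ (fderiv ℝ ψ) y a w) := by
    have h1 := fderiv_bilinear_apply hG₁ (differentiableAt_const v) (differentiableAt_const w) a
    rw [(hG v w).fderiv_eq, fderiv_bilinear_apply (B := fun x ↦ G₂ (ψ x))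
      (differentiableAt_comp_bilinear hG₂ hψ1)
      (hev' v) (hev' w)] at h1
    rw [fderiv_comp_bilinear_apply hG₂ hψ1, hev, hev] at h1
    simpa using h1.symm
  unfold christoffelLower
  -- Of the six second-derivative terms, four cancel by symmetry of `D²ψ` and of `G₂`; the remaining
  -- two coincide and absorb the factor `1 / 2`.
  rw [key, key, key, hsym2 v u, hsym2 z u, hsym2 z v,
    hsymm (fderiv ℝ ψ y v) (fderiv ℝ (fderiv ℝ ψ) y u z),
    hsymm (fderiv ℝ ψ y u) (fderiv ℝ (fderiv ℝ ψ) y v z)]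
  ring

/-- If a vector field `X` on a parametrized submanifold `F` is orthogonal to the submanifold, then
so is `∇_X X`. -/
theorem orthogonal_covDeriv_of_orthogonal {G : E → E →L[ℝ] E →L[ℝ] ℝ} {f : F → E} {X : F → F}
    {u : F} (hG : DifferentiableAt ℝ G (f u)) (hf : ContDiffAt ℝ 2 f u)
    (hX : DifferentiableAt ℝ X u) (hsymm : ∀ y v w, G y v w = G y w v)
    (h0 : ∀ᶠ x in 𝓝 u, ∀ a, G (f x) (fderiv ℝ f x a) (fderiv ℝ f x (X x)) = 0) (a : F) :
    G (f u) (fderiv ℝ (fun x ↦ fderiv ℝ f x (X x)) u (X u)) (fderiv ℝ f u a) +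
      christoffelLower G (f u) (fderiv ℝ f u (X u)) (fderiv ℝ f u (X u)) (fderiv ℝ f u a) = 0 := by
  have hf1 : DifferentiableAt ℝ f u := hf.differentiableAt (by norm_num)
  have hf2 : DifferentiableAt ℝ (fderiv ℝ f) u :=
    (hf.fderiv_right (m := 1) (by norm_num)).differentiableAt (by norm_num)
  have hsym2 (a b : F) : fderiv ℝ (fderiv ℝ f) u a b = fderiv ℝ (fderiv ℝ f) u b a :=
    (hf.isSymmSndFDerivAt (by simp)).eq a b
  have hA : DifferentiableAt ℝ (fun x ↦ fderiv ℝ f x a) u :=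
    hf2.clm_apply (differentiableAt_const a)
  have hV : DifferentiableAt ℝ (fun x ↦ fderiv ℝ f x (X x)) u := hf2.clm_apply hX
  have hGf : DifferentiableAt ℝ (fun x ↦ G (f x)) u :=
    differentiableAt_comp_bilinear hG hf1
  have hGf' (b : F) : fderiv ℝ (fun x ↦ G (f x)) u b = fderiv ℝ G (f u) (fderiv ℝ f u b) :=
    fderiv_comp_bilinear_apply hG hf1 b
  have hA' (b : F) : fderiv ℝ (fun x ↦ fderiv ℝ f x a) u b = fderiv ℝ (fderiv ℝ f) u b a := by
    rw [(hf2.hasFDerivAt.clm_apply (hasFDerivAt_const a u)).fderiv]; simp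
  have hV' (b : F) : fderiv ℝ (fun x ↦ fderiv ℝ f x (X x)) u b =
      fderiv ℝ (fderiv ℝ f) u b (X u) + fderiv ℝ f u (fderiv ℝ X u b) := by
    rw [(hf2.hasFDerivAt.clm_apply hX.hasFDerivAt).fderiv]; simp [add_comm]
  -- With `V = df(X)`, the relation `⟨∂_a f, V⟩ = 0` is differentiated along `X`, and `⟨V, V⟩ = 0`
  -- along `a`. Both produce `⟨D²f(a, X), V⟩`, since the rest of `∂_a V` is tangential and so
  -- orthogonal to `V`. Eliminating that term leaves the claim.
  have e1 : fderiv ℝ (fun x ↦ G (f x) (fderiv ℝ f x a) (fderiv ℝ f x (X x))) u (X u) = 0 := by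
    rw [Filter.EventuallyEq.fderiv_eq (f := fun _ ↦ (0 : ℝ)) (h0.mono fun x hx ↦ hx a)]; simp
  have e2 : fderiv ℝ (fun x ↦ G (f x) (fderiv ℝ f x (X x)) (fderiv ℝ f x (X x))) u a = 0 := by
    rw [Filter.EventuallyEq.fderiv_eq (f := fun _ ↦ (0 : ℝ)) (h0.mono fun x hx ↦ hx _)]; simp
  have h0u := h0.self_of_nhds
  rw [fderiv_bilinear_apply hGf hA hV, hGf', hA', hsym2] at e1
  rw [fderiv_bilinear_apply hGf hV hV, hGf', hsymm _ (fderiv ℝ f u (X u))] at e2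
  nth_rewrite 1 2 [hV'] at e2
  simp only [map_add, add_apply, h0u] at e2
  unfold christoffelLower
  have hD : ∀ b v w, fderiv ℝ G (f u) b v w = fderiv ℝ G (f u) b w v := by
    intro b v w
    have h1 := fderiv_bilinear_apply hG (differentiableAt_const v) (differentiableAt_const w) b
    have h2 := fderiv_bilinear_apply hG (differentiableAt_const w) (differentiableAt_const v) b
    simp only [hsymm _ v w] at h1
    simp at h1 h2
    rw [← h1, h2]
  rw [hsymm, hD _ _ (fderiv ℝ f u a)]
  linarith

end FlatCalculus

/-! ### Tangent vectors and the metric in charts. -/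

section Coordinates

variable {E : Type*} [NormedAddCommGroup E] [NormedSpace ℝ E]
  {M : Type*} [TopologicalSpace M] [ChartedSpace E M] [IsManifold 𝓘(ℝ, E) ∞ M]

theorem symmL_trivializationAt_tangent {p q : M} (hq : q ∈ (extChartAt 𝓘(ℝ, E) p).source) (v : E) :
    (trivializationAt E (TangentSpace 𝓘(ℝ, E)) p).symmL ℝ q v =
      tangentCoordChange 𝓘(ℝ, E) p q q v := by
  rw [extChartAt_source] at hq
  exact congrArg (fun T : E →L[ℝ] E ↦ T v)
    (TangentBundle.symmL_trivializationAt_eq_core (I := 𝓘(ℝ, E)) hq)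

theorem symm_trivializationAt_tangent {p q : M} (hq : q ∈ (extChartAt 𝓘(ℝ, E) p).source) (v : E) :
    (trivializationAt E (TangentSpace 𝓘(ℝ, E)) p).symm q v =
      tangentCoordChange 𝓘(ℝ, E) p q q v := by
  rw [← symmL_trivializationAt_tangent hq]
  refine (Trivialization.symmL_apply (R := ℝ) _ ?_ v).symm
  rwa [extChartAt_source] at hq

theorem hasFDerivAt_transition {p r z : M} (hp : z ∈ (extChartAt 𝓘(ℝ, E) p).source)
    (hr : z ∈ (extChartAt 𝓘(ℝ, E) r).source) :
    HasFDerivAt (extChartAt 𝓘(ℝ, E) r ∘ (extChartAt 𝓘(ℝ, E) p).symm)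
      (tangentCoordChange 𝓘(ℝ, E) p r z) (extChartAt 𝓘(ℝ, E) p z) := by
  have := hasFDerivWithinAt_tangentCoordChange (I := 𝓘(ℝ, E)) ⟨hp, hr⟩
  simpa using this

theorem contDiffAt_transition {p r z : M} (hp : z ∈ (extChartAt 𝓘(ℝ, E) p).source)
    (hr : z ∈ (extChartAt 𝓘(ℝ, E) r).source) :
    ContDiffAt ℝ ∞ (extChartAt 𝓘(ℝ, E) r ∘ (extChartAt 𝓘(ℝ, E) p).symm)
      (extChartAt 𝓘(ℝ, E) p z) := by
  have h' : extChartAt 𝓘(ℝ, E) p z ∈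
      ((extChartAt 𝓘(ℝ, E) p).symm ≫ (extChartAt 𝓘(ℝ, E) r)).source := by
    rw [PartialEquiv.trans_source'', PartialEquiv.symm_symm, PartialEquiv.symm_target]
    exact mem_image_of_mem _ ⟨hp, hr⟩
  have := contDiffWithinAt_ext_coord_change (I := 𝓘(ℝ, E)) (n := ∞) r p h'
  rwa [modelWithCornersSelf_coe, range_id, contDiffWithinAt_univ] at this

theorem hasMFDerivAt_extChartAt_coord {p q : M} (hq : q ∈ (extChartAt 𝓘(ℝ, E) p).source) :
    HasMFDerivAt 𝓘(ℝ, E) 𝓘(ℝ, E) (extChartAt 𝓘(ℝ, E) p) q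
      (show E →L[ℝ] E from tangentCoordChange 𝓘(ℝ, E) q p q) := by
  rw [extChartAt_source] at hq
  exact (hasMFDerivAt_extChartAt (I := 𝓘(ℝ, E)) hq).congr_mfderiv
    (mfderiv_chartAt_eq_tangentCoordChange hq)

theorem hasDerivAt_extChartAt_comp {c : ℝ → M} {t : ℝ} {p : M} {v : E}
    (hc : HasMFDerivAt 𝓘(ℝ, ℝ) 𝓘(ℝ, E) c t ((1 : ℝ →L[ℝ] ℝ).smulRight v))
    (hp : c t ∈ (extChartAt 𝓘(ℝ, E) p).source) :
    HasDerivAt (fun s ↦ extChartAt 𝓘(ℝ, E) p (c s)) (tangentCoordChange 𝓘(ℝ, E) (c t) p (c t) v)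
      t := by
  have h := (hasMFDerivAt_extChartAt_coord hp).comp t hc
  rw [hasMFDerivAt_iff_hasFDerivAt] at h
  rw [hasDerivAt_iff_hasFDerivAt]
  refine h.congr_fderiv ?_
  refine ContinuousLinearMap.ext_ring ?_
  change tangentCoordChange 𝓘(ℝ, E) (c t) p (c t) ((1 : ℝ) • v) =
    (1 : ℝ) • tangentCoordChange 𝓘(ℝ, E) (c t) p (c t) v
  rw [map_smul]

omit [IsManifold 𝓘(ℝ, E) ∞ M] in
theorem eventually_mem_extChartAt_source {X : Type*} [TopologicalSpace X] {f : X → M} {x : X}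
    {p : M} (hf : ContinuousAt f x) (hp : f x ∈ (extChartAt 𝓘(ℝ, E) p).source) :
    ∀ᶠ y in 𝓝 x, f y ∈ (extChartAt 𝓘(ℝ, E) p).source :=
  hf.eventually ((isOpen_extChartAt_source p).mem_nhds hp)

namespace SpacetimeStructure

variable (g : SpacetimeStructure E M)

/-- The metric at `q` as a bilinear form on the model space. -/
noncomputable def form (q : M) : E →L[ℝ] E →L[ℝ] ℝ := g.metric q

theorem form_symm (q : M) (v w : E) : g.form q v w = g.form q w v := g.symm q v w

theorem chartMetric_extChartAt_apply {p q : M} (hq : q ∈ (extChartAt 𝓘(ℝ, E) p).source) (v w : E) :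
    g.chartMetric p (extChartAt 𝓘(ℝ, E) p q) v w =
      g.form q (tangentCoordChange 𝓘(ℝ, E) p q q v) (tangentCoordChange 𝓘(ℝ, E) p q q w) := by
  have h1 : (extChartAt 𝓘(ℝ, E) p).symm (extChartAt 𝓘(ℝ, E) p q) = q :=
    (extChartAt 𝓘(ℝ, E) p).left_inv hq
  -- The base point of `chartMetric` is `φ⁻¹ (φ q)`, only propositionally equal to `q`; a free `q`
  -- allows the equality to be substituted in the dependent types.
  have h3 (y : E) : ∀ q, (extChartAt 𝓘(ℝ, E) p).symm y = q → g.chartMetric p y v w =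
      g.form q ((trivializationAt E (TangentSpace 𝓘(ℝ, E)) p).symmL ℝ q v)
        ((trivializationAt E (TangentSpace 𝓘(ℝ, E)) p).symmL ℝ q w) := by
    rintro q rfl
    rfl
  rw [h3 _ q h1]
  exact congrArg₂ (fun a b : E ↦ g.form q a b) (symmL_trivializationAt_tangent hq v)
    (symmL_trivializationAt_tangent hq w)

theorem chartMetric_symm (p : M) (y v w : E) : g.chartMetric p y v w = g.chartMetric p y w v :=
  g.symm _ _ _

theorem chartMetric_self (p : M) : g.chartMetric p (extChartAt 𝓘(ℝ, E) p p) = g.form p := by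
  ext v w
  rw [g.chartMetric_extChartAt_apply (mem_extChartAt_source p),
    tangentCoordChange_self (mem_extChartAt_source p),
    tangentCoordChange_self (mem_extChartAt_source p)]

/-- The metric of two vectors in terms of their coordinates. -/
theorem chartMetric_coord {p q : M} (hq : q ∈ (extChartAt 𝓘(ℝ, E) p).source) (v w : E) :
    g.chartMetric p (extChartAt 𝓘(ℝ, E) p q) (tangentCoordChange 𝓘(ℝ, E) q p q v)
      (tangentCoordChange 𝓘(ℝ, E) q p q w) = g.form q v w := by
  rw [g.chartMetric_extChartAt_apply hq,
    tangentCoordChange_comp ⟨⟨mem_extChartAt_source q, hq⟩, mem_extChartAt_source q⟩,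
    tangentCoordChange_comp ⟨⟨mem_extChartAt_source q, hq⟩, mem_extChartAt_source q⟩,
    tangentCoordChange_self (mem_extChartAt_source q),
    tangentCoordChange_self (mem_extChartAt_source q)]

/-- Read in the trivialization at `p`, the smooth section `g.metric` is `chartMetric p` composed
with the chart; composing with the inverse chart gives smoothness in the coordinates. -/
theorem contDiffAt_chartMetric {p q : M} (hq : q ∈ (extChartAt 𝓘(ℝ, E) p).source) :
    ContDiffAt ℝ ∞ (g.chartMetric p) (extChartAt 𝓘(ℝ, E) p q) := by
  have h1 := g.contMDiff_metric q
  have hq' : q ∈ (chartAt E p).source := by rwa [extChartAt_source] at hq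
  have h2 := ((trivializationAt (E →L[ℝ] E →L[ℝ] ℝ)
    (fun q : M ↦ TangentSpace 𝓘(ℝ, E) q →L[ℝ] TangentSpace 𝓘(ℝ, E) q →L[ℝ] ℝ)
    p).contMDiffAt_section_iff (x₀ := q) (n := ∞) (IB := 𝓘(ℝ, E)) (s := g.metric)
    (by simpa using hq')).1 h1
  have h3 : ContMDiffAt 𝓘(ℝ, E) 𝓘(ℝ, E →L[ℝ] E →L[ℝ] ℝ) ∞
      (fun x ↦ g.chartMetric p (extChartAt 𝓘(ℝ, E) p x)) q := by
    refine h2.congr_of_eventuallyEq ?_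
    filter_upwards [(isOpen_extChartAt_source (I := 𝓘(ℝ, E)) p).mem_nhds hq] with x hx
    have hx' : x ∈ (chartAt E p).source := by rwa [extChartAt_source] at hx
    ext v w
    rw [hom_trivializationAt_apply]
    refine Eq.symm ((inCoordinates_apply_eq₂ (F₁ := E) (F₂ := E) (F₃ := ℝ)
      (E₃ := Bundle.Trivial M ℝ) (by simpa using hx') (by simpa using hx') (by simp)).trans ?_)
    rw [g.chartMetric_extChartAt_apply hx]
    refine Eq.trans ?_ (congrArg₂ (fun a b : E ↦ g.form x a b)
      (symm_trivializationAt_tangent hx v) (symm_trivializationAt_tangent hx w))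
    rw [Trivialization.linearMapAt_apply, if_pos (by simp)]
    rfl
  have h4 : ContMDiffAt 𝓘(ℝ, E) 𝓘(ℝ, E →L[ℝ] E →L[ℝ] ℝ) ∞
      ((fun x ↦ g.chartMetric p (extChartAt 𝓘(ℝ, E) p x)) ∘ (extChartAt 𝓘(ℝ, E) p).symm)
      (extChartAt 𝓘(ℝ, E) p q) := by
    refine ContMDiffAt.comp _ ?_ ((contMDiffOn_extChartAt_symm p).contMDiffAt
      (extChartAt_target_mem_nhds' ((extChartAt 𝓘(ℝ, E) p).map_source hq)))
    rwa [(extChartAt 𝓘(ℝ, E) p).left_inv hq]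
  rw [contMDiffAt_iff_contDiffAt] at h4
  refine h4.congr_of_eventuallyEq ?_
  filter_upwards [extChartAt_target_mem_nhds' (I := 𝓘(ℝ, E))
    ((extChartAt 𝓘(ℝ, E) p).map_source hq)] with y hy
  rw [Function.comp_apply, (extChartAt 𝓘(ℝ, E) p).right_inv hy]

variable [FiniteDimensional ℝ E]

theorem form_sharp (p : M) (α : E →L[ℝ] ℝ) (z : E) : g.form p (g.sharp p α) z = α z := by
  have := (LinearEquiv.ofBijective (g.metric p).toLinearMap (g.flat_bijective p)).apply_symm_apply α
  exact congrArg (fun T : E →L[ℝ] ℝ ↦ T z) this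

/-- The Christoffel symbols as vectors of the model space. -/
noncomputable def christoffelVec (p : M) (u v : E) : E := g.christoffel p u v

/-- Lowering the index removes `sharp`, so the inverse metric need never be differentiated. Combined
with `eq_of_form_eq`, it allows vector identities to be checked on pairings with `z`. -/
theorem form_christoffelVec (p : M) (u v z : E) :
    g.form p (g.christoffelVec p u v) z =
      christoffelLower (g.chartMetric p) (extChartAt 𝓘(ℝ, E) p p) u v z :=
  g.form_sharp p _ z

theorem eq_of_form_eq {p : M} {v w : E} (h : ∀ z, g.form p v z = g.form p w z) : v = w :=
  (g.flat_bijective p).1 (ContinuousLinearMap.ext h)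

end SpacetimeStructure

end Coordinates

/-! ### Linear algebra of null vectors and degenerate hyperplanes. -/

section LorentzAlgebra

variable {E : Type*} [NormedAddCommGroup E] [NormedSpace ℝ E]
  {M : Type*} [TopologicalSpace M] [ChartedSpace E M] [IsManifold 𝓘(ℝ, E) ∞ M]

namespace SpacetimeStructure

variable (g : SpacetimeStructure E M)

/-- Orthogonal null vectors are proportional. -/
theorem exists_smul_eq_of_null_of_null (p : M) {a b : E} (ha : a ≠ 0) (haa : g.form p a a = 0)
    (hbb : g.form p b b = 0) (hab : g.form p a b = 0) : ∃ k : ℝ, b = k • a := by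
  obtain ⟨e, -, he⟩ := g.lorentzian p
  replace he : ∀ w : E, g.form p e w = 0 → w ≠ 0 → 0 < g.form p w w := he
  have hea : g.form p e a ≠ 0 := fun h ↦ (he a h ha).ne' haa
  -- This coefficient makes `b - k • a` orthogonal to the timelike `e`. The difference is also null,
  -- so positivity on the complement of `e` forces it to vanish.
  refine ⟨g.form p e b / g.form p e a, ?_⟩
  by_contra h
  have h1 := he (b - (g.form p e b / g.form p e a) • a)
    (by simp [div_mul_cancel₀ _ hea]) (sub_ne_zero.2 h)
  have hba : g.form p b a = 0 := by rw [g.form_symm, hab]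
  simp [haa, hbb, hab, hba] at h1

variable {E' : Type*} [NormedAddCommGroup E'] [NormedSpace ℝ E']

/-- `H n` is null and orthogonal to the null vector `H v`, hence a multiple of it, and so inherits
its orthogonality to the range of `H`. -/
theorem orthogonal_of_null {p : M} {H : E' →L[ℝ] E} (hH : Function.Injective H) {v n : E'}
    (hv : v ≠ 0) (hvw : ∀ w, g.form p (H v) (H w) = 0)
    (hnn : g.form p (H n) (H n) = 0) (w : E') : g.form p (H n) (H w) = 0 := by
  have hHv : H v ≠ 0 := fun h ↦ hv (hH (by simpa using h))
  obtain ⟨k, hk⟩ := g.exists_smul_eq_of_null_of_null p hHv (hvw v) hnn (hvw n)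
  rw [hk, map_smul, smul_apply, hvw, smul_zero]

/-- If `u` lies in the hyperplane, it is orthogonal to itself and to `H n`, so the two null vectors
are proportional. Otherwise `u` and the hyperplane span `E`, and `H n` would be orthogonal to
everything, against nondegeneracy. -/
theorem exists_smul_eq_of_orthogonal [FiniteDimensional ℝ E] {p : M} {H : E' →L[ℝ] E}
    (hH : Function.Injective H) (hdim : Module.finrank ℝ E = Module.finrank ℝ E' + 1) {n : E'}
    (hn : n ≠ 0) (hnw : ∀ w, g.form p (H n) (H w) = 0) {u : E}
    (hu : ∀ w, g.form p u (H w) = 0) : ∃ k : ℝ, u = k • H n := by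
  have hHn : H n ≠ 0 := fun h ↦ hn (hH (by simpa using h))
  by_cases hmem : ∃ w, H w = u
  · obtain ⟨w, rfl⟩ := hmem
    exact g.exists_smul_eq_of_null_of_null p hHn (hnw n) (hu w) (hnw w)
  · exfalso
    have hlt : H.toLinearMap.range < H.toLinearMap.range ⊔ Submodule.span ℝ {u} := by
      refine lt_of_le_of_ne le_sup_left fun h ↦ hmem ?_
      have : u ∈ H.toLinearMap.range := by
        rw [h]
        exact Submodule.mem_sup_right (Submodule.mem_span_singleton_self u)
      simpa using this
    have h1 := Submodule.finrank_lt_finrank_of_lt hlt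
    rw [LinearMap.finrank_range_of_inj hH] at h1
    have h2 : H.toLinearMap.range ⊔ Submodule.span ℝ {u} = ⊤ :=
      Submodule.eq_top_of_finrank_eq (le_antisymm (Submodule.finrank_le _) (by omega))
    refine hHn (g.eq_of_form_eq (p := p) fun z ↦ ?_)
    have hz : z ∈ H.toLinearMap.range ⊔ Submodule.span ℝ {u} := h2 ▸ Submodule.mem_top
    obtain ⟨_, ⟨w, rfl⟩, _, hy, rfl⟩ := Submodule.mem_sup.1 hz
    obtain ⟨k, rfl⟩ := Submodule.mem_span_singleton.1 hy
    have h3 : g.form p (H n) u = 0 := by rw [g.form_symm, hu]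
    have h4 := hnw w
    simp [h3, h4]

end SpacetimeStructure

end LorentzAlgebra

/-! ### Covariant derivatives along maps and curves. -/

section CovariantDerivative

variable {E : Type*} [NormedAddCommGroup E] [NormedSpace ℝ E] [FiniteDimensional ℝ E]
  {M : Type*} [TopologicalSpace M] [ChartedSpace E M] [IsManifold 𝓘(ℝ, E) ∞ M]

namespace SpacetimeStructure

variable (g : SpacetimeStructure E M)

theorem christoffelVec_smul_smul (p : M) (a b : ℝ) (u v : E) :
    g.christoffelVec p (a • u) (b • v) = ((a * b) • g.christoffelVec p u v : E) := by
  refine g.eq_of_form_eq (p := p) fun z ↦ ?_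
  have h := g.form_christoffelVec p (a • u) (b • v) z
  have h' := g.form_christoffelVec p u v z
  rw [map_smul, smul_apply, h']
  refine h.trans ?_
  simp only [christoffelLower, map_smul, smul_apply, smul_eq_mul]
  ring

theorem covDerivAlong_eq {c : ℝ → M} {V : ℝ → E} {t : ℝ} {x' v' : E}
    (hc : HasMFDerivAt 𝓘(ℝ, ℝ) 𝓘(ℝ, E) c t ((1 : ℝ →L[ℝ] ℝ).smulRight x'))
    (hV : HasDerivAt (fun s ↦ tangentCoordChange 𝓘(ℝ, E) (c s) (c t) (c s) (V s)) v' t) :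
    g.covDerivAlong (E' := ℝ) c V t (1 : ℝ) = (v' + g.christoffelVec (c t) x' (V t) : E) := by
  have h1 : mfderiv 𝓘(ℝ, ℝ) 𝓘(ℝ, E)
      (fun s ↦ tangentCoordChange 𝓘(ℝ, E) (c s) (c t) (c s) (V s)) t (1 : ℝ) = v' := by
    rw [mfderiv_eq_fderiv]
    exact hV.deriv
  have h2 : (mfderiv 𝓘(ℝ, ℝ) 𝓘(ℝ, E) c t (1 : ℝ) : E) = x' := by
    rw [hc.mfderiv]
    exact one_smul ℝ x'
  exact congrArg₂ (fun a b : E ↦ (a + g.christoffelVec (c t) b (V t) : E)) h1 h2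

/-- The covariant derivative along a curve, computed in an arbitrary chart. -/
theorem form_covDerivAlong {c : ℝ → M} {V : ℝ → E} {t : ℝ} {p : M} {x' v' : E}
    (hc : HasMFDerivAt 𝓘(ℝ, ℝ) 𝓘(ℝ, E) c t ((1 : ℝ →L[ℝ] ℝ).smulRight x'))
    (hp : c t ∈ (extChartAt 𝓘(ℝ, E) p).source)
    (hV : HasDerivAt (fun s ↦ tangentCoordChange 𝓘(ℝ, E) (c s) p (c s) (V s)) v' t) (z : E) :
    g.form (c t) (g.covDerivAlong (E' := ℝ) c V t (1 : ℝ))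
        (tangentCoordChange 𝓘(ℝ, E) p (c t) (c t) z) =
      g.chartMetric p (extChartAt 𝓘(ℝ, E) p (c t)) v' z +
        christoffelLower (g.chartMetric p) (extChartAt 𝓘(ℝ, E) p (c t))
          (tangentCoordChange 𝓘(ℝ, E) (c t) p (c t) x')
          (tangentCoordChange 𝓘(ℝ, E) (c t) p (c t) (V t)) z := by
  set r := c t with hr
  have hrr : r ∈ (extChartAt 𝓘(ℝ, E) r).source := mem_extChartAt_source r
  set ψ : E → E := extChartAt 𝓘(ℝ, E) r ∘ (extChartAt 𝓘(ℝ, E) p).symm with hψdef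
  set y := extChartAt 𝓘(ℝ, E) p r with hy
  have hψ : ContDiffAt ℝ 2 ψ y := (contDiffAt_transition hp hrr).of_le (by norm_cast)
  have hψy : ψ y = extChartAt 𝓘(ℝ, E) r r := by
    rw [hψdef, hy, Function.comp_apply, (extChartAt 𝓘(ℝ, E) p).left_inv hp]
  have hDψ {q : M} (hq : q ∈ (extChartAt 𝓘(ℝ, E) p).source)
      (hq' : q ∈ (extChartAt 𝓘(ℝ, E) r).source) :
      fderiv ℝ ψ (extChartAt 𝓘(ℝ, E) p q) = tangentCoordChange 𝓘(ℝ, E) p r q :=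
    (hasFDerivAt_transition hq hq').fderiv
  have hback (v : E) :
      tangentCoordChange 𝓘(ℝ, E) p r r (tangentCoordChange 𝓘(ℝ, E) r p r v) = v := by
    rw [tangentCoordChange_comp ⟨⟨hrr, hp⟩, hrr⟩, tangentCoordChange_self hrr]
  have hcc : ContinuousAt c t := hc.continuousAt
  have hx := hasDerivAt_extChartAt_comp hc hp
  have hψ2 : DifferentiableAt ℝ (fderiv ℝ ψ) y :=
    (hψ.fderiv_right (m := 1) (by norm_num)).differentiableAt (by norm_num)
  -- The coordinates in the chart at `r` are `dψ` applied to those in the chart at `p`. The product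
  -- rule adds a `D²ψ` term, which matches the inhomogeneous term of the Christoffel transformation
  -- law.
  have hV2 : HasDerivAt (fun s ↦ tangentCoordChange 𝓘(ℝ, E) (c s) r (c s) (V s))
      (fderiv ℝ (fderiv ℝ ψ) y (tangentCoordChange 𝓘(ℝ, E) r p r x')
        (tangentCoordChange 𝓘(ℝ, E) r p r (V t)) + fderiv ℝ ψ y v') t := by
    have h1 := (hψ2.hasFDerivAt.comp_hasDerivAt_of_eq t hx hy).clm_apply hV
    refine h1.congr_of_eventuallyEq ?_
    filter_upwards [eventually_mem_extChartAt_source hcc hp,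
      eventually_mem_extChartAt_source hcc (p := r) hrr] with s hs hs'
    simp only [Function.comp_apply]
    rw [hDψ hs hs', tangentCoordChange_comp ⟨⟨mem_extChartAt_source _, hs⟩, hs'⟩]
  have hcov := g.covDerivAlong_eq hc hV2
  have hG : ∀ v w, (fun x ↦ g.chartMetric p x v w) =ᶠ[𝓝 y]
      fun x ↦ g.chartMetric r (ψ x) (fderiv ℝ ψ x v) (fderiv ℝ ψ x w) := by
    intro v w
    have hev : ∀ᶠ x in 𝓝 y, (extChartAt 𝓘(ℝ, E) p).symm x ∈ (extChartAt 𝓘(ℝ, E) r).source := by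
      refine eventually_mem_extChartAt_source
        (continuousAt_extChartAt_symm' hp) ?_
      rwa [(extChartAt 𝓘(ℝ, E) p).left_inv hp]
    filter_upwards [extChartAt_target_mem_nhds' (I := 𝓘(ℝ, E))
      ((extChartAt 𝓘(ℝ, E) p).map_source hp), hev] with x hx hx'
    obtain ⟨q, hq, rfl⟩ : ∃ q ∈ (extChartAt 𝓘(ℝ, E) p).source, extChartAt 𝓘(ℝ, E) p q = x :=
      ⟨_, (extChartAt 𝓘(ℝ, E) p).map_target hx, (extChartAt 𝓘(ℝ, E) p).right_inv hx⟩
    rw [(extChartAt 𝓘(ℝ, E) p).left_inv hq] at hx'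
    rw [hDψ hq hx', hψdef, Function.comp_apply, (extChartAt 𝓘(ℝ, E) p).left_inv hq,
      g.chartMetric_extChartAt_apply hq, g.chartMetric_extChartAt_apply hx',
      tangentCoordChange_comp ⟨⟨hq, hx'⟩, mem_extChartAt_source q⟩,
      tangentCoordChange_comp ⟨⟨hq, hx'⟩, mem_extChartAt_source q⟩]
  have htr := christoffelLower_pullback
    ((g.contDiffAt_chartMetric hp).differentiableAt (by simp))
    (hψy ▸ (g.contDiffAt_chartMetric hrr).differentiableAt (by simp)) hψ
    (g.chartMetric_symm r _) hG (tangentCoordChange 𝓘(ℝ, E) r p r x')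
    (tangentCoordChange 𝓘(ℝ, E) r p r (V t)) z
  rw [htr, g.chartMetric_extChartAt_apply hp, hψy, g.chartMetric_self, hDψ hp hrr, hback, hback,
    ← g.form_christoffelVec]
  rw [hDψ hp hrr] at hcov
  refine (congrArg (fun a : E ↦ g.form r a (tangentCoordChange 𝓘(ℝ, E) p r r z)) hcov).trans ?_
  simp only [map_add, add_apply]
  ring

/-- Both sides use the preferred chart at `F (γ t)`, so the chain rule suffices. This turns
covariant derivatives on `L` into derivatives along integral curves. -/
theorem covDerivAlong_comp {E' : Type*} [NormedAddCommGroup E'] [NormedSpace ℝ E']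
    {N : Type*} [TopologicalSpace N] [ChartedSpace E' N] {F : N → M} {V : N → E} {γ : ℝ → N}
    {t : ℝ} {u : E'}
    (hγ : HasMFDerivAt 𝓘(ℝ, ℝ) 𝓘(ℝ, E') γ t ((1 : ℝ →L[ℝ] ℝ).smulRight u))
    (hF : MDifferentiableAt 𝓘(ℝ, E') 𝓘(ℝ, E) F (γ t))
    (hV : MDifferentiableAt 𝓘(ℝ, E') 𝓘(ℝ, E)
      (fun y ↦ tangentCoordChange 𝓘(ℝ, E) (F y) (F (γ t)) (F y) (V y)) (γ t)) :
    g.covDerivAlong (E' := ℝ) (F ∘ γ) (fun s ↦ V (γ s)) t (1 : ℝ) =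
      g.covDerivAlong F V (γ t) u := by
  have h1 := (hF.hasMFDerivAt.comp t hγ).mfderiv
  have h2 := (hV.hasMFDerivAt.comp t hγ).mfderiv
  have h1' : mfderiv 𝓘(ℝ, ℝ) 𝓘(ℝ, E) (F ∘ γ) t (1 : ℝ) =
      mfderiv 𝓘(ℝ, E') 𝓘(ℝ, E) F (γ t) u := by
    rw [h1]
    exact congrArg (mfderiv 𝓘(ℝ, E') 𝓘(ℝ, E) F (γ t)) (one_smul ℝ u)
  have h2' : mfderiv 𝓘(ℝ, ℝ) 𝓘(ℝ, E) ((fun y ↦ tangentCoordChange 𝓘(ℝ, E) (F y) (F (γ t)) (F y)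
      (V y)) ∘ γ) t (1 : ℝ) = mfderiv 𝓘(ℝ, E') 𝓘(ℝ, E)
      (fun y ↦ tangentCoordChange 𝓘(ℝ, E) (F y) (F (γ t)) (F y) (V y)) (γ t) u := by
    rw [h2]
    exact congrArg (mfderiv 𝓘(ℝ, E') 𝓘(ℝ, E) _ (γ t)) (one_smul ℝ u)
  exact congrArg₂ (fun a b : E ↦ (a + g.christoffelVec (F (γ t)) b (V (γ t)) : E)) h2' h1'

theorem covDerivAlong_smul {E' : Type*} [NormedAddCommGroup E'] [NormedSpace ℝ E']
    {N : Type*} [TopologicalSpace N] [ChartedSpace E' N] (F : N → M) (V : N → E) (x : N) (a : ℝ)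
    (u : E') : g.covDerivAlong F V x (a • u) = (a • g.covDerivAlong F V x u : E) := by
  have h1 : mfderiv 𝓘(ℝ, E') 𝓘(ℝ, E) F x (a • u) =
      (a • mfderiv 𝓘(ℝ, E') 𝓘(ℝ, E) F x u : E) := map_smul _ _ _
  have h2 : mfderiv 𝓘(ℝ, E') 𝓘(ℝ, E)
      (fun y ↦ tangentCoordChange 𝓘(ℝ, E) (F y) (F x) (F y) (V y)) x (a • u) =
      (a • mfderiv 𝓘(ℝ, E') 𝓘(ℝ, E)
        (fun y ↦ tangentCoordChange 𝓘(ℝ, E) (F y) (F x) (F y) (V y)) x u : E) := map_smul _ _ _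
  have h3 := g.christoffelVec_smul_smul (F x) a 1 (mfderiv 𝓘(ℝ, E') 𝓘(ℝ, E) F x u) (V x)
  rw [one_smul, mul_one] at h3
  refine (congrArg₂ (fun a b : E ↦ (a + g.christoffelVec (F x) b (V x) : E)) h2 h1).trans ?_
  refine (congrArg (fun b : E ↦ (_ + b : E)) h3).trans ?_
  exact (smul_add a _ _).symm

/-- The covariant derivative of `f • W` along a reparametrized curve. -/
theorem covDerivAlong_reparam {c : ℝ → M} {W : ℝ → E} {τ f : ℝ → ℝ} {s τ' f' : ℝ} {x' w' a : E}
    (hc : HasMFDerivAt 𝓘(ℝ, ℝ) 𝓘(ℝ, E) c (τ s) ((1 : ℝ →L[ℝ] ℝ).smulRight x'))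
    (hW : HasDerivAt (fun t ↦ tangentCoordChange 𝓘(ℝ, E) (c t) (c (τ s)) (c t) (W t)) w' (τ s))
    (hτ : HasDerivAt τ τ' s) (hf : HasDerivAt f f' s)
    (ha : g.covDerivAlong (E' := ℝ) c W (τ s) (1 : ℝ) = a) :
    g.covDerivAlong (E' := ℝ) (c ∘ τ) (fun r ↦ (f r • W (τ r) : E)) s (1 : ℝ) =
      (f' • W (τ s) + (f s * τ') • a : E) := by
  have hcτ : HasMFDerivAt 𝓘(ℝ, ℝ) 𝓘(ℝ, E) (c ∘ τ) s ((1 : ℝ →L[ℝ] ℝ).smulRight (τ' • x')) := by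
    refine (hc.comp s hτ.hasFDerivAt.hasMFDerivAt).congr_mfderiv ?_
    refine ContinuousLinearMap.ext_ring ?_
    change ((1 : ℝ) • τ') • x' = (1 : ℝ) • (τ' • x')
    simp
  have hfW : HasDerivAt (fun r ↦ tangentCoordChange 𝓘(ℝ, E) ((c ∘ τ) r) ((c ∘ τ) s) ((c ∘ τ) r)
      (f r • W (τ r))) (f s • (τ' • w') + f' • W (τ s)) s := by
    have h := hf.smul (HasDerivAt.scomp s hW hτ)
    simp only [Function.comp_apply, tangentCoordChange_self (mem_extChartAt_source (c (τ s)))] at h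
    refine h.congr_of_eventuallyEq (.of_forall fun r ↦ ?_)
    exact map_smul _ _ _
  rw [g.covDerivAlong_eq hc hW] at ha
  rw [g.covDerivAlong_eq hcτ hfW, ← ha]
  refine (congrArg (fun b : E ↦ (f s • (τ' • w') + f' • W (τ s) + b : E))
    (g.christoffelVec_smul_smul (c (τ s)) τ' (f s) x' (W (τ s)))).trans ?_
  module

end SpacetimeStructure

end CovariantDerivative

/-- The differential of an immersion is injective. -/
theorem Manifold.IsImmersionAt.mfderiv_injective {𝕜 : Type*} [NontriviallyNormedField 𝕜]
    {E F : Type*} [NormedAddCommGroup E] [NormedSpace 𝕜 E] [NormedAddCommGroup F] [NormedSpace 𝕜 F]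
    {n : WithTop ℕ∞} {M N : Type*} [TopologicalSpace M] [ChartedSpace E M] [IsManifold 𝓘(𝕜, E) n M]
    [TopologicalSpace N] [ChartedSpace F N] [IsManifold 𝓘(𝕜, F) n N] {f : M → N} {x : M}
    (hn : n ≠ 0) (h : Manifold.IsImmersionAt 𝓘(𝕜, E) 𝓘(𝕜, F) n f x) :
    Function.Injective (mfderiv 𝓘(𝕜, E) 𝓘(𝕜, F) f x) := by
  have hdom := h.mem_domChart_source
  -- In immersion charts `f` is `u ↦ (u, 0)`, so projecting to the first factor recovers the chart
  -- of the domain: `f` has a differentiable local left inverse.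
  have hρ : MDifferentiableAt 𝓘(𝕜, F) 𝓘(𝕜, E)
      (fun y ↦ (h.equiv.symm (h.codChart y)).1) (f x) := by
    have h1 := (contMDiffAt_of_mem_maximalAtlas h.codChart_mem_maximalAtlas
      h.mem_codChart_source).mdifferentiableAt hn
    have h2 : DifferentiableAt 𝕜 (fun z ↦ (h.equiv.symm z).1) (h.codChart (f x)) :=
      ((ContinuousLinearMap.fst 𝕜 E h.complement).comp
        (h.equiv.symm : F →L[𝕜] E × h.complement)).differentiableAt
    exact h2.mdifferentiableAt.comp (f x) h1
  have heq : (fun y ↦ (h.equiv.symm (h.codChart y)).1) ∘ f =ᶠ[𝓝 x] h.domChart := by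
    filter_upwards [h.domChart.open_source.mem_nhds hdom] with y hy
    have hmem : h.domChart y ∈ (h.domChart.extend 𝓘(𝕜, E)).target := by
      simpa [OpenPartialHomeomorph.extend_target] using h.domChart.map_source hy
    have h1 := h.writtenInCharts hmem
    have h2 : h.codChart (f y) = h.equiv (h.domChart y, 0) := by
      simpa [h.domChart.left_inv hy] using h1
    simp [h2]
  have hd := (contMDiffAt_of_mem_maximalAtlas h.domChart_mem_maximalAtlas hdom).mdifferentiableAt hn
  have hs := (contMDiffAt_symm_of_mem_maximalAtlas h.domChart_mem_maximalAtlas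
    (h.domChart.map_source hdom)).mdifferentiableAt hn
  have hf : MDifferentiableAt 𝓘(𝕜, E) 𝓘(𝕜, F) f x := h.contMDiffAt.mdifferentiableAt hn
  have hinv : h.domChart.symm ∘ h.domChart =ᶠ[𝓝 x] id := by
    filter_upwards [h.domChart.open_source.mem_nhds hdom] with y hy
    exact h.domChart.left_inv hy
  have h1 := (hs.hasMFDerivAt.comp x hd.hasMFDerivAt).congr_of_eventuallyEq hinv.symm
  have h2 := hasMFDerivAt_unique h1 (hasMFDerivAt_id x)
  have h3 := hasMFDerivAt_unique ((hρ.hasMFDerivAt.comp x hf.hasMFDerivAt).congr_of_eventuallyEq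
    heq.symm) hd.hasMFDerivAt
  rw [← h3] at h2
  refine Function.LeftInverse.injective (g := fun v ↦ mfderiv 𝓘(𝕜, E) 𝓘(𝕜, E) h.domChart.symm
    (h.domChart x) (mfderiv 𝓘(𝕜, F) 𝓘(𝕜, E) (fun y ↦ (h.equiv.symm (h.codChart y)).1) (f x) v))
    fun v ↦ congrArg (fun T : E →L[𝕜] E ↦ T v) h2

/-! ### Null sections as normal fields; existence of the surface gravity. -/

section NullHypersurface

variable {E : Type*} [NormedAddCommGroup E] [NormedSpace ℝ E]
  {M : Type*} [TopologicalSpace M] [ChartedSpace E M] [IsManifold 𝓘(ℝ, E) ∞ M]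
  {E' : Type*} [NormedAddCommGroup E'] [NormedSpace ℝ E']
  {L : Type*} [TopologicalSpace L] [ChartedSpace E' L] [IsManifold 𝓘(ℝ, E') ∞ L]
  {i : L → M}

/-- The push-forward of tangent vectors as a map of model spaces. -/
noncomputable def pushLinear (E : Type*) [NormedAddCommGroup E] [NormedSpace ℝ E]
    {M : Type*} [TopologicalSpace M] [ChartedSpace E M]
    (E' : Type*) [NormedAddCommGroup E'] [NormedSpace ℝ E']
    {L : Type*} [TopologicalSpace L] [ChartedSpace E' L] (i : L → M) (x : L) : E' →L[ℝ] E :=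
  mfderiv 𝓘(ℝ, E') 𝓘(ℝ, E) i x

theorem contMDiffAt_tangentCoordChange_section {η : L → E'}
    (hη : ContMDiff 𝓘(ℝ, E') 𝓘(ℝ, E').tangent ∞ (fun x ↦ (⟨x, η x⟩ : TangentBundle 𝓘(ℝ, E') L)))
    (x : L) :
    ContMDiffAt 𝓘(ℝ, E') 𝓘(ℝ, E') ∞ (fun y ↦ tangentCoordChange 𝓘(ℝ, E') y x y (η y)) x :=
  (contMDiffAt_totalSpace.1 (hη x)).2

theorem contMDiffAt_tangentCoordChange_push (hi : ContMDiff 𝓘(ℝ, E') 𝓘(ℝ, E) ∞ i)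
    {η : L → E'}
    (hη : ContMDiff 𝓘(ℝ, E') 𝓘(ℝ, E').tangent ∞ (fun x ↦ (⟨x, η x⟩ : TangentBundle 𝓘(ℝ, E') L)))
    (x : L) :
    ContMDiffAt 𝓘(ℝ, E') 𝓘(ℝ, E) ∞
      (fun y ↦ tangentCoordChange 𝓘(ℝ, E) (i y) (i x) (i y) (pushLinear E E' i y (η y))) x := by
  have h := (hi.contMDiff_tangentMap (m := ∞) (by simp)).comp hη
  exact (contMDiffAt_totalSpace.1 (h x)).2

theorem contDiffAt_writtenInCharts (hi : ContMDiff 𝓘(ℝ, E') 𝓘(ℝ, E) ∞ i) {x y : L} {p : M}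
    (hy : y ∈ (extChartAt 𝓘(ℝ, E') x).source) (hp : i y ∈ (extChartAt 𝓘(ℝ, E) p).source) :
    ContDiffAt ℝ ∞ (extChartAt 𝓘(ℝ, E) p ∘ i ∘ (extChartAt 𝓘(ℝ, E') x).symm)
      (extChartAt 𝓘(ℝ, E') x y) := by
  rw [← contMDiffAt_iff_contDiffAt]
  rw [extChartAt_source] at hp
  have h1 : ContMDiffAt 𝓘(ℝ, E') 𝓘(ℝ, E') ∞ (extChartAt 𝓘(ℝ, E') x).symm
      (extChartAt 𝓘(ℝ, E') x y) := (contMDiffOn_extChartAt_symm x).contMDiffAt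
      (extChartAt_target_mem_nhds' ((extChartAt 𝓘(ℝ, E') x).map_source hy))
  have h2 : ContMDiffAt 𝓘(ℝ, E') 𝓘(ℝ, E) ∞ (extChartAt 𝓘(ℝ, E) p ∘ i)
      ((extChartAt 𝓘(ℝ, E') x).symm (extChartAt 𝓘(ℝ, E') x y)) := by
    rw [(extChartAt 𝓘(ℝ, E') x).left_inv hy]
    exact (contMDiffAt_extChartAt' hp).comp y (hi y)
  exact h2.comp _ h1

theorem fderiv_writtenInCharts (hi : ContMDiff 𝓘(ℝ, E') 𝓘(ℝ, E) ∞ i) {x y : L} {p : M}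
    (hy : y ∈ (extChartAt 𝓘(ℝ, E') x).source) (hp : i y ∈ (extChartAt 𝓘(ℝ, E) p).source)
    (w : E') :
    fderiv ℝ (extChartAt 𝓘(ℝ, E) p ∘ i ∘ (extChartAt 𝓘(ℝ, E') x).symm) (extChartAt 𝓘(ℝ, E') x y)
      (tangentCoordChange 𝓘(ℝ, E') y x y w) =
      tangentCoordChange 𝓘(ℝ, E) (i y) p (i y) (pushLinear E E' i y w) := by
  have h1 := (hasMFDerivAt_extChartAt_coord hp).comp y
    ((hi y).mdifferentiableAt (by simp)).hasMFDerivAt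
  have h2 := ((contDiffAt_writtenInCharts hi hy hp).differentiableAt
    (by simp)).hasFDerivAt.hasMFDerivAt.comp y (hasMFDerivAt_extChartAt_coord hy)
  have h3 := h2.congr_of_eventuallyEq (f₁ := extChartAt 𝓘(ℝ, E) p ∘ i) (by
    filter_upwards [(isOpen_extChartAt_source (I := 𝓘(ℝ, E')) x).mem_nhds hy] with z hz
    simp only [Function.comp_apply]
    rw [(extChartAt 𝓘(ℝ, E') x).left_inv hz])
  exact congrArg (fun T : E' →L[ℝ] E ↦ T w) (hasMFDerivAt_unique h3 h1)

variable {g : SpacetimeStructure E M}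

namespace IsNullHypersurface

omit [IsManifold 𝓘(ℝ, E') ∞ L] in
theorem contMDiff (hL : IsNullHypersurface (E' := E') g i) : ContMDiff 𝓘(ℝ, E') 𝓘(ℝ, E) ∞ i :=
  hL.isSmoothEmbedding.contMDiff

theorem pushLinear_injective (hL : IsNullHypersurface (E' := E') g i) (x : L) :
    Function.Injective (pushLinear E E' i x) :=
  Manifold.IsImmersionAt.mfderiv_injective (by simp)
    (hL.isSmoothEmbedding.isImmersion.isImmersionAt x)

theorem form_push_eq_zero (hL : IsNullHypersurface (E' := E') g i)
    {η : L → E'} (hη : IsNullSection g i η) (x : L) (w : E') :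
    g.form (i x) (pushLinear E E' i x (η x)) (pushLinear E E' i x w) = 0 := by
  obtain ⟨v, hv, hvw⟩ := hL.degenerate x
  exact g.orthogonal_of_null (hL.pushLinear_injective x) hv hvw (hη.null x) w

variable [FiniteDimensional ℝ E]

/-- In charts `η` becomes a field `X` on a parametrized hypersurface `f`, tangent and normal to it.
By `orthogonal_covDeriv_of_orthogonal` its covariant derivative along itself is again normal, and
the normals form the line spanned by `η`. -/
theorem exists_covDeriv_eq_smul (hL : IsNullHypersurface (E' := E') g i)
    {η : L → E'} (hη : IsNullSection g i η) (x : L) :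
    ∃ k : ℝ, g.covDerivAlong i (fun y ↦ pushVector i (η y)) x (η x) =
      k • pushVector i (η x) := by
  set u := extChartAt 𝓘(ℝ, E') x x with hu
  set f : E' → E := extChartAt 𝓘(ℝ, E) (i x) ∘ i ∘ (extChartAt 𝓘(ℝ, E') x).symm with hf
  have hx : x ∈ (extChartAt 𝓘(ℝ, E') x).source := mem_extChartAt_source x
  have hix : i x ∈ (extChartAt 𝓘(ℝ, E) (i x)).source := mem_extChartAt_source (i x)
  have hi := hL.contMDiff
  set X : E' → E' := (fun y ↦ tangentCoordChange 𝓘(ℝ, E') y x y (η y)) ∘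
    (extChartAt 𝓘(ℝ, E') x).symm with hX
  have hfC := contDiffAt_writtenInCharts hi hx hix
  have hXd : DifferentiableAt ℝ X u := by
    have h1 : ContMDiffAt 𝓘(ℝ, E') 𝓘(ℝ, E') ∞ (extChartAt 𝓘(ℝ, E') x).symm u :=
      (contMDiffOn_extChartAt_symm x).contMDiffAt (extChartAt_target_mem_nhds x)
    have h2 : ContMDiffAt 𝓘(ℝ, E') 𝓘(ℝ, E') ∞ X u :=
      ContMDiffAt.comp_of_eq (contMDiffAt_tangentCoordChange_section hη.contMDiff x) h1
        ((extChartAt 𝓘(ℝ, E') x).left_inv hx)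
    exact (contMDiffAt_iff_contDiffAt.1 h2).differentiableAt (by simp)
  have hfu : f u = extChartAt 𝓘(ℝ, E) (i x) (i x) := by
    rw [hf, hu, Function.comp_apply, Function.comp_apply, (extChartAt 𝓘(ℝ, E') x).left_inv hx]
  have hXu : X u = η x := by
    rw [hX, hu, Function.comp_apply, (extChartAt 𝓘(ℝ, E') x).left_inv hx]
    exact tangentCoordChange_self hx
  have hfd {y : L} (hy : y ∈ (extChartAt 𝓘(ℝ, E') x).source)
      (hp : i y ∈ (extChartAt 𝓘(ℝ, E) (i x)).source) (w : E') :=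
    fderiv_writtenInCharts hi hy hp w
  have hfdx (w : E') : fderiv ℝ f u w = pushLinear E E' i x w := by
    have h := hfd hx hix w
    rwa [tangentCoordChange_self hx, tangentCoordChange_self hix] at h
  have hev : ∀ᶠ y in 𝓝 x, i y ∈ (extChartAt 𝓘(ℝ, E) (i x)).source :=
    eventually_mem_extChartAt_source hi.continuous.continuousAt hix
  have hXy {y : L} (hy : y ∈ (extChartAt 𝓘(ℝ, E') x).source) :
      X (extChartAt 𝓘(ℝ, E') x y) = tangentCoordChange 𝓘(ℝ, E') y x y (η y) := by
    rw [hX, Function.comp_apply, (extChartAt 𝓘(ℝ, E') x).left_inv hy]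
  have h0 : ∀ᶠ z in 𝓝 u, ∀ a,
      g.chartMetric (i x) (f z) (fderiv ℝ f z a) (fderiv ℝ f z (X z)) = 0 := by
    have hev' : ∀ᶠ z in 𝓝 u, i ((extChartAt 𝓘(ℝ, E') x).symm z) ∈
        (extChartAt 𝓘(ℝ, E) (i x)).source := by
      refine eventually_mem_extChartAt_source (f := i ∘ (extChartAt 𝓘(ℝ, E') x).symm)
        (hi.continuous.continuousAt.comp (continuousAt_extChartAt_symm x)) ?_
      rwa [hu, Function.comp_apply, (extChartAt 𝓘(ℝ, E') x).left_inv hx]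
    filter_upwards [extChartAt_target_mem_nhds (I := 𝓘(ℝ, E')) x, hev'] with z hz hz' a
    obtain ⟨y, hy, rfl⟩ : ∃ y ∈ (extChartAt 𝓘(ℝ, E') x).source, extChartAt 𝓘(ℝ, E') x y = z :=
      ⟨_, (extChartAt 𝓘(ℝ, E') x).map_target hz, (extChartAt 𝓘(ℝ, E') x).right_inv hz⟩
    rw [(extChartAt 𝓘(ℝ, E') x).left_inv hy] at hz'
    have ha : a = tangentCoordChange 𝓘(ℝ, E') y x y (tangentCoordChange 𝓘(ℝ, E') x y y a) := by
      rw [tangentCoordChange_comp ⟨⟨hy, mem_extChartAt_source y⟩, hy⟩, tangentCoordChange_self hy]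
    rw [ha, hXy hy, hfd hy hz', hfd hy hz' (η y), hf, Function.comp_apply, Function.comp_apply,
      (extChartAt 𝓘(ℝ, E') x).left_inv hy, g.chartMetric_coord hz', g.form_symm]
    exact hL.form_push_eq_zero hη y _
  have hflat := orthogonal_covDeriv_of_orthogonal (G := g.chartMetric (i x)) (f := f) (X := X)
    (u := u) (hfu ▸ (g.contDiffAt_chartMetric hix).differentiableAt (by simp))
    (hfC.of_le (by norm_cast)) hXd (g.chartMetric_symm (i x)) h0
  have hV : mfderiv 𝓘(ℝ, E') 𝓘(ℝ, E)
      (fun y ↦ tangentCoordChange 𝓘(ℝ, E) (i y) (i x) (i y) (pushLinear E E' i y (η y))) x (η x) =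
      fderiv ℝ (fun z ↦ fderiv ℝ f z (X z)) u (X u) := by
    have hd : DifferentiableAt ℝ (fun z ↦ fderiv ℝ f z (X z)) u :=
      ((hfC.fderiv_right (m := 1) (by norm_cast)).differentiableAt (by norm_num)).clm_apply hXd
    have h2 := (hd.hasFDerivAt.hasMFDerivAt.comp x
      (hasMFDerivAt_extChartAt_coord hx)).congr_of_eventuallyEq (f₁ := fun y ↦
        tangentCoordChange 𝓘(ℝ, E) (i y) (i x) (i y) (pushLinear E E' i y (η y))) (by
      filter_upwards [(isOpen_extChartAt_source (I := 𝓘(ℝ, E')) x).mem_nhds hx, hev] with y hy hy'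
      change _ = fderiv ℝ f (extChartAt 𝓘(ℝ, E') x y) (X (extChartAt 𝓘(ℝ, E') x y))
      rw [hXy hy, hfd hy hy'])
    rw [h2.mfderiv, hXu]
    exact congrArg (fderiv ℝ (fun z ↦ fderiv ℝ f z (X z)) u) (tangentCoordChange_self hx)
  have hcov : g.covDerivAlong i (fun y ↦ pushVector i (η y)) x (η x) =
      (fderiv ℝ (fun z ↦ fderiv ℝ f z (X z)) u (X u) +
        g.christoffelVec (i x) (pushLinear E E' i x (η x)) (pushLinear E E' i x (η x)) : E) :=
    congrArg (fun a : E ↦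
      (a + g.christoffelVec (i x) (pushLinear E E' i x (η x)) (pushLinear E E' i x (η x)) : E)) hV
  rw [hcov]
  refine g.exists_smul_eq_of_orthogonal (hL.pushLinear_injective x) hL.codim_one (hη.ne_zero x)
    (hL.form_push_eq_zero hη x) fun w ↦ ?_
  have h := hflat w
  rw [hfu, g.chartMetric_self, hfdx, hXu, hfdx, ← g.form_christoffelVec] at h
  rw [hXu, map_add, add_apply]
  exact h

theorem surfaceGravity_spec (hL : IsNullHypersurface (E' := E') g i)
    {η : L → E'} (hη : IsNullSection g i η) (x : L) :
    g.covDerivAlong i (fun y ↦ pushVector i (η y)) x (η x) =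
      surfaceGravity g i η x • pushVector i (η x) := by
  have h := hL.exists_covDeriv_eq_smul hη x
  rw [show surfaceGravity g i η x = h.choose from dif_pos h]
  exact h.choose_spec

omit [FiniteDimensional ℝ E] in
/-- Two null sections are pointwise proportional. -/
theorem exists_smul_eq (hL : IsNullHypersurface (E' := E') g i)
    {ξ η : L → E'} (hξ : IsNullSection g i ξ)
    (hη : IsNullSection g i η) (x : L) : ∃ k : ℝ, η x = k • ξ x := by
  have hne : pushLinear E E' i x (ξ x) ≠ 0 := fun h ↦
    hξ.ne_zero x (hL.pushLinear_injective x (h.trans (map_zero _).symm))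
  obtain ⟨k, hk⟩ := g.exists_smul_eq_of_null_of_null (i x) hne (hξ.null x) (hη.null x)
    (hL.form_push_eq_zero hξ x (η x))
  refine ⟨k, hL.pushLinear_injective x (hk.trans (map_smul _ _ _).symm)⟩

end IsNullHypersurface

end NullHypersurface

/-! ### The two ordinary differential equations along a generator. -/

section RealAnalysis

theorem hasDerivAt_integral_of_continuous {f : ℝ → ℝ} (hf : Continuous f) (t : ℝ) :
    HasDerivAt (fun t ↦ ∫ r in (0 : ℝ)..t, f r) (f t) t :=
  intervalIntegral.integral_hasDerivAt_right (hf.intervalIntegrable _ _)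
    hf.aestronglyMeasurable.stronglyMeasurableAtFilter hf.continuousAt

theorem contDiff_integral {f : ℝ → ℝ} (hf : ContDiff ℝ ∞ f) :
    ContDiff ℝ ∞ (fun t ↦ ∫ r in (0 : ℝ)..t, f r) := by
  have h := hasDerivAt_integral_of_continuous hf.continuous
  rw [contDiff_infty_iff_deriv]
  refine ⟨fun t ↦ (h t).differentiableAt, ?_⟩
  rwa [show deriv (fun t ↦ ∫ r in (0 : ℝ)..t, f r) = f from funext fun t ↦ (h t).deriv]

/-- A solution on the whole line of the equation `τ'' = - κ(τ) τ'²` of affine parametrizations. -/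
theorem exists_affine_parameter {κ : ℝ → ℝ} (hκ : ContDiff ℝ ∞ κ) (hpos : ∀ t, 0 ≤ t → 0 ≤ κ t)
    (hneg : ∀ t, t ≤ 0 → κ t ≤ 0) :
    ∃ τ : ℝ → ℝ, ContDiff ℝ ∞ τ ∧ τ 0 = 0 ∧ deriv τ 0 = 1 ∧ (∀ s, 0 < deriv τ s) ∧
      ∀ s, HasDerivAt (deriv τ) (-(κ (τ s) * deriv τ s ^ 2)) s := by
  set K : ℝ → ℝ := fun t ↦ ∫ r in (0 : ℝ)..t, κ r with hK
  have hK' := hasDerivAt_integral_of_continuous hκ.continuous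
  have hKc : ContDiff ℝ ∞ K := contDiff_integral hκ
  have hK0 (t : ℝ) : 0 ≤ K t := by
    rcases le_total 0 t with ht | ht
    · exact intervalIntegral.integral_nonneg ht fun u hu ↦ hpos u hu.1
    · rw [hK]
      simp only
      rw [intervalIntegral.integral_symm, ← intervalIntegral.integral_neg]
      exact intervalIntegral.integral_nonneg ht fun u hu ↦ neg_nonneg.2 (hneg u hu.2)
  have hec : ContDiff ℝ ∞ (fun t ↦ Real.exp (K t)) := Real.contDiff_exp.comp hKc
  set S : ℝ → ℝ := fun t ↦ ∫ r in (0 : ℝ)..t, Real.exp (K r) with hS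
  have hS' (t : ℝ) : HasDerivAt S (Real.exp (K t)) t :=
    hasDerivAt_integral_of_continuous hec.continuous t
  have hSc : ContDiff ℝ ∞ S := contDiff_integral hec
  have hmono : StrictMono S := strictMono_of_deriv_pos fun t ↦ by
    rw [(hS' t).deriv]
    exact Real.exp_pos _
  have hS0 : S 0 = 0 := by simp [hS]
  -- `K ≥ 0` gives `S' = exp K ≥ 1`, so `S` dominates `t` in the future and is dominated by it in
  -- the past. Hence `S` is onto, and its inverse `τ` is defined on the whole line.
  have hdiff : Monotone (fun t ↦ S t - t) := by
    refine monotone_of_deriv_nonneg (fun t ↦ ((hS' t).sub (hasDerivAt_id t)).differentiableAt)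
      fun t ↦ ?_
    rw [show deriv (fun t ↦ S t - t) t = Real.exp (K t) - 1 from
      ((hS' t).sub (hasDerivAt_id t)).deriv]
    linarith [Real.one_le_exp (hK0 t)]
  have hsurj : Function.Surjective S := by
    refine hSc.continuous.surjective ?_ ?_
    · refine Filter.tendsto_atTop_mono' _ ?_ Filter.tendsto_id
      filter_upwards [Filter.eventually_ge_atTop 0] with t ht
      have := hdiff ht
      simp only [hS0, id] at this ⊢
      linarith
    · refine Filter.tendsto_atBot_mono' _ ?_ Filter.tendsto_id
      filter_upwards [Filter.eventually_le_atBot 0] with t ht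
      have := hdiff ht
      simp only [hS0, id] at this ⊢
      linarith
  set e : ℝ ≃ₜ ℝ := (StrictMono.orderIsoOfSurjective S hmono hsurj).toHomeomorph with he
  have heS (t : ℝ) : e t = S t := rfl
  set τ : ℝ → ℝ := ⇑e.symm with hτ
  have hτc : ContDiff ℝ ∞ τ :=
    e.contDiff_symm_deriv (fun t ↦ (Real.exp_pos (K t)).ne') hS' hSc
  have hτ0 : τ 0 = 0 := by
    rw [hτ, Homeomorph.symm_apply_eq, heS, hS0]
  have hτ' (s : ℝ) : HasDerivAt τ (Real.exp (-K (τ s))) s := by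
    rw [Real.exp_neg]
    exact HasDerivAt.of_local_left_inverse e.symm.continuous.continuousAt (hS' (τ s))
      (Real.exp_pos _).ne' (.of_forall fun s ↦ e.apply_symm_apply s)
  have hd : deriv τ = fun s ↦ Real.exp (-K (τ s)) := funext fun s ↦ (hτ' s).deriv
  refine ⟨τ, hτc, hτ0, ?_, fun s ↦ ?_, fun s ↦ ?_⟩
  · rw [hd]
    simp [hτ0, hK]
  · rw [hd]
    exact Real.exp_pos _
  · rw [hd]
    refine ((hK' (τ s)).comp s (hτ' s)).neg.exp.congr_deriv ?_
    simp only [Function.comp_apply, Pi.neg_apply]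
    ring

/-- A solution of `f' = c - κ f` with `c > 0` vanishes somewhere if `κ` has the sign of `t`. -/
theorem exists_eq_zero_of_deriv_of_pos {f κ : ℝ → ℝ} {c : ℝ} (hc : 0 < c)
    (hf : ∀ t, HasDerivAt f (c - κ t * f t) t) (hpos : ∀ t, 0 ≤ t → 0 ≤ κ t)
    (hneg : ∀ t, t ≤ 0 → κ t ≤ 0) : ∃ t, f t = 0 := by
  by_contra! h
  have hcont : Continuous f := continuous_iff_continuousAt.2 fun t ↦ (hf t).continuousAt
  have hd (t : ℝ) : HasDerivAt (fun t ↦ f t - c * t) (-(κ t * f t)) t :=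
    ((hf t).sub ((hasDerivAt_id t).const_mul c)).congr_deriv (by simp)
  have hdc : Continuous (fun t ↦ f t - c * t) :=
    continuous_iff_continuousAt.2 fun t ↦ (hd t).continuousAt
  rcases (h 0).lt_or_gt with h0 | h0
  · have hlt (t : ℝ) : f t < 0 := by
      by_contra! ht
      obtain ⟨s, hs⟩ := mem_range_of_exists_le_of_exists_ge hcont ⟨0, h0.le⟩ ⟨t, ht⟩
      exact h s hs
    have hm : MonotoneOn (fun t ↦ f t - c * t) (Ici 0) := by
      refine monotoneOn_of_deriv_nonneg (convex_Ici 0) hdc.continuousOn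
        (fun t _ ↦ (hd t).differentiableAt.differentiableWithinAt) fun t ht ↦ ?_
      rw [interior_Ici] at ht
      rw [(hd t).deriv]
      nlinarith [hpos t (le_of_lt ht), hlt t]
    -- For `f < 0`, the term `-κ f` is nonnegative in the future, so `f t ≥ f 0 + c t` there. The
    -- chosen time is the zero of this line; the case `f > 0` uses the same time, now in the past.
    have hT : 0 ≤ -f 0 / c := div_nonneg (by linarith) hc.le
    have h1 := hm self_mem_Ici hT hT
    simp only [mul_zero, sub_zero, mul_div_cancel₀ _ hc.ne'] at h1
    linarith [hlt (-f 0 / c)]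
  · have hgt (t : ℝ) : 0 < f t := by
      by_contra! ht
      obtain ⟨s, hs⟩ := mem_range_of_exists_le_of_exists_ge hcont ⟨t, ht⟩ ⟨0, h0.le⟩
      exact h s hs
    have hm : MonotoneOn (fun t ↦ f t - c * t) (Iic 0) := by
      refine monotoneOn_of_deriv_nonneg (convex_Iic 0) hdc.continuousOn
        (fun t _ ↦ (hd t).differentiableAt.differentiableWithinAt) fun t ht ↦ ?_
      rw [interior_Iic] at ht
      rw [(hd t).deriv]
      nlinarith [hneg t (le_of_lt ht), hgt t]
    have hT : -f 0 / c ≤ 0 := div_nonpos_of_nonpos_of_nonneg (by linarith) hc.le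
    have h1 := hm hT self_mem_Iic hT
    simp only [mul_zero, sub_zero, mul_div_cancel₀ _ hc.ne'] at h1
    linarith [hgt (-f 0 / c)]

theorem exists_eq_zero_of_deriv {f κ : ℝ → ℝ} {c : ℝ} (hc : c ≠ 0)
    (hf : ∀ t, HasDerivAt f (c - κ t * f t) t) (hpos : ∀ t, 0 ≤ t → 0 ≤ κ t)
    (hneg : ∀ t, t ≤ 0 → κ t ≤ 0) : ∃ t, f t = 0 := by
  rcases hc.lt_or_gt with hc | hc
  · obtain ⟨t, ht⟩ := exists_eq_zero_of_deriv_of_pos (f := -f) (neg_pos.2 hc)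
      (fun t ↦ (hf t).neg.congr_deriv (by simp; ring)) hpos hneg
    exact ⟨t, by simpa using ht⟩
  · exact exists_eq_zero_of_deriv_of_pos hc hf hpos hneg

end RealAnalysis

/-! ### Regularity of integral curves. -/

section IntegralCurve

variable {E' : Type*} [NormedAddCommGroup E'] [NormedSpace ℝ E']
  {L : Type*} [TopologicalSpace L] [ChartedSpace E' L] [IsManifold 𝓘(ℝ, E') ∞ L]

/-- Integral curves of smooth vector fields are smooth. -/
theorem IsMIntegralCurve.contMDiff {ξ : L → E'} {γ : ℝ → L}
    (hξ : ContMDiff 𝓘(ℝ, E') 𝓘(ℝ, E').tangent ∞ (fun x ↦ (⟨x, ξ x⟩ : TangentBundle 𝓘(ℝ, E') L)))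
    (hγ : IsMIntegralCurve γ (I := 𝓘(ℝ, E')) ξ) : ContMDiff 𝓘(ℝ, ℝ) 𝓘(ℝ, E') ∞ γ := by
  rw [contMDiff_infty]
  intro n
  induction n with
  | zero => exact contMDiff_zero_iff.2 hγ.continuous
  | succ n ih =>
    intro t
    have hsrc : γ t ∈ (extChartAt 𝓘(ℝ, E') (γ t)).source := mem_extChartAt_source _
    refine contMDiffAt_iff_target.2 ⟨hγ.continuous.continuousAt, contMDiffAt_iff_contDiffAt.2 ?_⟩
    -- Bootstrap: the velocity of `γ` is `ξ` along `γ`, which is as regular as `γ` itself, so `γ`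
    -- gains one derivative.
    have hv : ContDiffAt ℝ n (fun s ↦ tangentCoordChange 𝓘(ℝ, E') (γ s) (γ t) (γ s) (ξ (γ s))) t :=
      contMDiffAt_iff_contDiffAt.1 (((contMDiffAt_tangentCoordChange_section hξ (γ t)).of_le
        (by exact_mod_cast le_top)).comp t (ih t))
    refine contDiffAt_succ_iff_hasFDerivAt.2 ⟨fun s ↦ ContinuousLinearMap.toSpanSingleton ℝ
      (tangentCoordChange 𝓘(ℝ, E') (γ s) (γ t) (γ s) (ξ (γ s))), ⟨_,
      eventually_mem_extChartAt_source hγ.continuous.continuousAt hsrc, fun s hs ↦ ?_⟩, ?_⟩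
    · exact (hasDerivAt_extChartAt_comp (hγ s) hs).hasFDerivAt
    · refine ((ContinuousLinearMap.toSpanSingletonCLE (𝕜 := ℝ) (E := E')).contDiff.contDiffAt.comp t
        hv).congr_of_eventuallyEq (.of_forall fun s ↦ ?_)
      ext
      simp

end IntegralCurve

/-! ### Surface gravity and geodesics along integral curves of null sections. -/

section Generators

variable {E : Type*} [NormedAddCommGroup E] [NormedSpace ℝ E] [FiniteDimensional ℝ E]
  {M : Type*} [TopologicalSpace M] [ChartedSpace E M] [IsManifold 𝓘(ℝ, E) ∞ M]
  {g : SpacetimeStructure E M}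
  {E' : Type*} [NormedAddCommGroup E'] [NormedSpace ℝ E']
  {L : Type*} [TopologicalSpace L] [ChartedSpace E' L] [IsManifold 𝓘(ℝ, E') ∞ L]
  {i : L → M}

namespace IsNullHypersurface

variable {ξ : L → E'} {γ : ℝ → L}

omit [FiniteDimensional ℝ E] in
theorem pushLinear_ne_zero (hL : IsNullHypersurface (E' := E') g i) (hξ : IsNullSection g i ξ)
    (x : L) : pushLinear E E' i x (ξ x) ≠ 0 := fun h ↦
  hξ.ne_zero x (hL.pushLinear_injective x (h.trans (map_zero _).symm))

omit [FiniteDimensional ℝ E] [IsManifold 𝓘(ℝ, E') ∞ L] in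
theorem hasMFDerivAt_comp_integralCurve (hL : IsNullHypersurface (E' := E') g i)
    (hγ : IsMIntegralCurve γ (I := 𝓘(ℝ, E')) ξ) (t : ℝ) :
    HasMFDerivAt 𝓘(ℝ, ℝ) 𝓘(ℝ, E) (i ∘ γ) t
      ((1 : ℝ →L[ℝ] ℝ).smulRight (pushLinear E E' i (γ t) (ξ (γ t)))) := by
  refine (((hL.contMDiff (γ t)).mdifferentiableAt (by simp)).hasMFDerivAt.comp t
    (hγ t)).congr_mfderiv ?_
  refine ContinuousLinearMap.ext_ring ?_
  exact map_smul (pushLinear E E' i (γ t)) (1 : ℝ) (ξ (γ t))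

theorem covDerivAlong_integralCurve (hL : IsNullHypersurface (E' := E') g i) {η : L → E'}
    (hη : IsNullSection g i η) (hγ : IsMIntegralCurve γ (I := 𝓘(ℝ, E')) ξ) (t : ℝ) :
    g.covDerivAlong (E' := ℝ) (i ∘ γ) (fun s ↦ pushLinear E E' i (γ s) (η (γ s))) t (1 : ℝ) =
      g.covDerivAlong i (fun y ↦ pushLinear E E' i y (η y)) (γ t) (ξ (γ t)) :=
  g.covDerivAlong_comp (V := fun y ↦ pushLinear E E' i y (η y)) (hγ t)
    ((hL.contMDiff (γ t)).mdifferentiableAt (by simp))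
    ((contMDiffAt_tangentCoordChange_push hL.contMDiff hη.contMDiff (γ t)).mdifferentiableAt
      (by simp))

theorem covDerivAlong_velocity_integralCurve (hL : IsNullHypersurface (E' := E') g i)
    (hξ : IsNullSection g i ξ) (hγ : IsMIntegralCurve γ (I := 𝓘(ℝ, E')) ξ) (t : ℝ) :
    g.covDerivAlong (E' := ℝ) (i ∘ γ) (fun s ↦ pushLinear E E' i (γ s) (ξ (γ s))) t (1 : ℝ) =
      (surfaceGravity g i ξ (γ t) • pushLinear E E' i (γ t) (ξ (γ t)) : E) :=
  (hL.covDerivAlong_integralCurve hξ hγ t).trans (hL.surfaceGravity_spec hξ (γ t))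

omit [FiniteDimensional ℝ E] in
theorem contDiffAt_push_integralCurve (hL : IsNullHypersurface (E' := E') g i) {η : L → E'}
    (hη : IsNullSection g i η) (hξ : IsNullSection g i ξ)
    (hγ : IsMIntegralCurve γ (I := 𝓘(ℝ, E')) ξ) (t : ℝ) :
    ContDiffAt ℝ ∞ (fun s ↦ tangentCoordChange 𝓘(ℝ, E) (i (γ s)) (i (γ t)) (i (γ s))
      (pushLinear E E' i (γ s) (η (γ s)))) t :=
  contMDiffAt_iff_contDiffAt.1 ((contMDiffAt_tangentCoordChange_push hL.contMDiff hη.contMDiff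
    (γ t)).comp t (hγ.contMDiff hξ.contMDiff t))

/-- The surface gravity is smooth along the integral curves. -/
theorem contDiff_surfaceGravity (hL : IsNullHypersurface (E' := E') g i)
    (hξ : IsNullSection g i ξ) (hγ : IsMIntegralCurve γ (I := 𝓘(ℝ, E')) ξ) :
    ContDiff ℝ ∞ (fun t ↦ surfaceGravity g i ξ (γ t)) := by
  rw [contDiff_iff_contDiffAt]
  intro t₀
  set p := i (γ t₀) with hp
  have hpp : (i ∘ γ) t₀ ∈ (extChartAt 𝓘(ℝ, E) p).source := mem_extChartAt_source p
  set W : ℝ → E := fun s ↦ pushLinear E E' i (γ s) (ξ (γ s)) with hW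
  set v : ℝ → E := fun s ↦ tangentCoordChange 𝓘(ℝ, E) ((i ∘ γ) s) p ((i ∘ γ) s) (W s) with hv
  set x : ℝ → E := fun s ↦ extChartAt 𝓘(ℝ, E) p ((i ∘ γ) s) with hx
  have hγs := hγ.contMDiff hξ.contMDiff
  have hc : ContMDiff 𝓘(ℝ, ℝ) 𝓘(ℝ, E) ∞ (i ∘ γ) := hL.contMDiff.comp hγs
  have hvC : ContDiffAt ℝ ∞ v t₀ := hL.contDiffAt_push_integralCurve hξ hξ hγ t₀
  have hxC : ContDiffAt ℝ ∞ x t₀ :=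
    contMDiffAt_iff_contDiffAt.1 (contMDiffAt_extChartAt.comp t₀ (hc t₀))
  have hv0 : v t₀ ≠ 0 := by
    have h : v t₀ = W t₀ := tangentCoordChange_self hpp
    rw [h]
    exact hL.pushLinear_ne_zero hξ (γ t₀)
  -- Pairing `∇_ξ ξ = κ ξ` with this constant `z` in the fixed chart at `p` exhibits `κ` near `t₀`
  -- as a quotient of smooth functions.
  obtain ⟨z, hz⟩ : ∃ z, g.chartMetric p (x t₀) (v t₀) z ≠ 0 := by
    by_contra! h
    refine hv0 (g.eq_of_form_eq (p := p) fun z ↦ ?_)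
    rw [← g.chartMetric_self, map_zero, zero_apply]
    exact h z
  have hG : ContDiffAt ℝ ∞ (g.chartMetric p) (x t₀) := g.contDiffAt_chartMetric hpp
  have hGx : ContDiffAt ℝ ∞ (fun t ↦ g.chartMetric p (x t)) t₀ := contDiffAt_comp_bilinear hG hxC
  have hv' : ContDiffAt ℝ ∞ (deriv v) t₀ := by
    have := hvC.fderiv_right (m := ∞) (by simp)
    exact this.clm_apply contDiffAt_const
  have hnum : ContDiffAt ℝ ∞ (fun t ↦ g.chartMetric p (x t) (deriv v t) z +
      christoffelLower (g.chartMetric p) (x t) (v t) (v t) z) t₀ := by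
    exact ((hGx.clm_apply hv').clm_apply contDiffAt_const).add
      (contDiffAt_christoffelLower hG hxC hvC hvC contDiffAt_const)
  have hden : ContDiffAt ℝ ∞ (fun t ↦ g.chartMetric p (x t) (v t) z) t₀ :=
    (hGx.clm_apply hvC).clm_apply contDiffAt_const
  refine (hnum.div hden hz).congr_of_eventuallyEq ?_
  filter_upwards [eventually_mem_extChartAt_source hc.continuous.continuousAt hpp,
    hden.continuousAt.eventually_ne hz,
    (hvC.of_le (m := 1) (by norm_cast)).eventually (by simp)] with t ht hzt hvt
  have hdv : HasDerivAt v (deriv v t) t := (hvt.differentiableAt (by simp)).hasDerivAt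
  have h := g.form_covDerivAlong (hL.hasMFDerivAt_comp_integralCurve hγ t) ht hdv z
  have hk : g.form ((i ∘ γ) t) (surfaceGravity g i ξ (γ t) • W t)
      (tangentCoordChange 𝓘(ℝ, E) p ((i ∘ γ) t) ((i ∘ γ) t) z) = _ :=
    (congrArg (fun a : E ↦ g.form ((i ∘ γ) t) a
      (tangentCoordChange 𝓘(ℝ, E) p ((i ∘ γ) t) ((i ∘ γ) t) z))
      (hL.covDerivAlong_velocity_integralCurve hξ hγ t)).symm.trans h
  have hWv : tangentCoordChange 𝓘(ℝ, E) p ((i ∘ γ) t) ((i ∘ γ) t) (v t) = W t := by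
    rw [hv, tangentCoordChange_comp ⟨⟨mem_extChartAt_source _, ht⟩, mem_extChartAt_source _⟩,
      tangentCoordChange_self (mem_extChartAt_source _)]
  have hWz := g.chartMetric_extChartAt_apply ht (v t) z
  rw [hWv] at hWz
  rw [map_smul, smul_apply, smul_eq_mul, ← hWz] at hk
  exact (eq_div_iff hzt).2 hk

/-- Null sections have no nonzero constant surface gravity along a curve where the surface gravity
of some null section has the sign of the parameter. -/
theorem surfaceGravity_not_const (hL : IsNullHypersurface (E' := E') g i)
    (hξ : IsNullSection g i ξ) (hγ : IsMIntegralCurve γ (I := 𝓘(ℝ, E')) ξ)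
    (hpos : ∀ t : ℝ, 0 ≤ t → 0 ≤ surfaceGravity g i ξ (γ t))
    (hneg : ∀ t : ℝ, t ≤ 0 → surfaceGravity g i ξ (γ t) ≤ 0) {η : L → E'}
    (hη : IsNullSection g i η) {c : ℝ} (hc : c ≠ 0) :
    ¬ ∀ x : L, surfaceGravity g i η x = c := by
  intro hηc
  choose f hf using fun t ↦ hL.exists_smul_eq hξ hη (γ t)
  replace hf : ∀ t, η (γ t) = f t • ξ (γ t) := hf
  have hf0 (t : ℝ) : f t ≠ 0 := fun h ↦ hη.ne_zero (γ t) (by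
    have := hf t
    rw [h, zero_smul] at this
    exact this)
  have hγs := hγ.contMDiff hξ.contMDiff
  have hcoord {ζ : L → E'} (hζ : IsNullSection g i ζ) (t : ℝ) :=
    contMDiffAt_iff_contDiffAt.1 ((contMDiffAt_tangentCoordChange_section hζ.contMDiff
      (γ t)).comp t (hγs t))
  have hfd (t₀ : ℝ) : DifferentiableAt ℝ f t₀ := by
    have h1 := (hcoord hξ t₀).differentiableAt (by simp)
    have h2 := (hcoord hη t₀).differentiableAt (by simp)
    have hne : ξ (γ t₀) ≠ 0 := hξ.ne_zero (γ t₀)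
    -- The factor `f` was chosen pointwise; near `t₀` it is the quotient of the `l`-components of
    -- `η` and `ξ`, hence differentiable.
    obtain ⟨l, hl⟩ := SeparatingDual.exists_ne_zero (R := ℝ) hne
    have h1' := l.differentiableAt.comp t₀ h1
    have h2' := l.differentiableAt.comp t₀ h2
    have hl0 : (l ∘ (fun y ↦ tangentCoordChange 𝓘(ℝ, E') y (γ t₀) y (ξ y)) ∘ γ) t₀ ≠ 0 := by
      simp only [Function.comp_apply]
      rwa [tangentCoordChange_self (mem_extChartAt_source _)]
    refine (h2'.div h1' hl0).congr_of_eventuallyEq ?_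
    filter_upwards [h1'.continuousAt.eventually_ne hl0] with t ht
    rw [Pi.div_apply, eq_div_iff ht]
    simp only [Function.comp_apply]
    rw [hf t, map_smul, map_smul, smul_eq_mul]
  refine absurd (exists_eq_zero_of_deriv hc (f := f) (fun t ↦ ?_) hpos hneg) (by simpa using hf0)
  set W : ℝ → E := fun s ↦ pushLinear E E' i (γ s) (ξ (γ s)) with hW
  have hWd := ((hL.contDiffAt_push_integralCurve hξ hξ hγ t).differentiableAt (by simp)).hasDerivAt
  have h1 := g.covDerivAlong_reparam (τ := id) (s := t) (c := i ∘ γ) (W := W)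
    (hL.hasMFDerivAt_comp_integralCurve hγ t) hWd (hasDerivAt_id t) (hfd t).hasDerivAt
    (hL.covDerivAlong_velocity_integralCurve hξ hγ t)
  have hηW : (fun s ↦ pushLinear E E' i (γ s) (η (γ s))) = fun s ↦ f s • W (id s) := by
    funext s
    rw [hf s, map_smul, hW]
    rfl
  have h2 := hL.covDerivAlong_integralCurve hη hγ t
  rw [hηW] at h2
  have h3 := hL.surfaceGravity_spec hη (γ t)
  have h4 := g.covDerivAlong_smul i (fun y ↦ pushLinear E E' i y (η y)) (γ t) (f t) (ξ (γ t))
  rw [← hf t] at h4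
  -- `∇_η η` computed twice: by the surface gravity of `η`, and as `f ∇_ξ (f ξ) = f (f' + f κ) ξ`.
  -- Cancelling `f` and `ξ` yields `f' = c - κ f`.
  have h5 : (surfaceGravity g i η (γ t) • pushLinear E E' i (γ t) (η (γ t)) : E) =
      f t • (deriv f t • W t + (f t * 1) • surfaceGravity g i ξ (γ t) • W t) :=
    (h3.symm.trans h4).trans (congrArg (fun a : E ↦ f t • a) (h2.symm.trans h1))
  have hW0 : W t ≠ 0 := hL.pushLinear_ne_zero hξ (γ t)
  rw [hηc, hf t, map_smul] at h5
  have h6 : (c * f t) • W t =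
      (f t * (deriv f t + f t * surfaceGravity g i ξ (γ t))) • W t := by
    refine Eq.trans ?_ (h5.trans ?_)
    · exact mul_smul c (f t) (W t)
    · module
  have h7 : c * f t = f t * (deriv f t + f t * surfaceGravity g i ξ (γ t)) :=
    smul_left_injective ℝ hW0 h6
  have h8 : deriv f t = c - surfaceGravity g i ξ (γ t) * f t := by
    have h9 : f t * (deriv f t + f t * surfaceGravity g i ξ (γ t)) = f t * c := by
      linarith
    linarith [mul_left_cancel₀ (hf0 t) h9]
  rw [← h8]
  exact (hfd t).hasDerivAt

omit [FiniteDimensional ℝ E] [IsManifold 𝓘(ℝ, E') ∞ L] in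
theorem velocity_reparam (hL : IsNullHypersurface (E' := E') g i)
    (hγ : IsMIntegralCurve γ (I := 𝓘(ℝ, E')) ξ) {τ : ℝ → ℝ} (hτ : ContDiff ℝ ∞ τ) (s : ℝ) :
    velocity (E := E) (i ∘ γ ∘ τ) s =
      (deriv τ s • pushLinear E E' i (γ (τ s)) (ξ (γ (τ s))) : E) := by
  have h := ((hL.hasMFDerivAt_comp_integralCurve hγ (τ s)).comp s
    ((hτ.differentiable (by simp)) s).hasDerivAt.hasFDerivAt.hasMFDerivAt).mfderiv
  refine (congrArg (fun T : ℝ →L[ℝ] E ↦ T 1) h).trans ?_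
  change ((1 : ℝ) • deriv τ s) • pushLinear E E' i (γ (τ s)) (ξ (γ (τ s))) = _
  rw [one_smul]

/-- Affine reparametrizations of the integral curves of a null section are geodesics. -/
theorem isGeodesicOn_reparam (hL : IsNullHypersurface (E' := E') g i)
    (hξ : IsNullSection g i ξ) (hγ : IsMIntegralCurve γ (I := 𝓘(ℝ, E')) ξ) {τ : ℝ → ℝ}
    (hτ : ContDiff ℝ ∞ τ)
    (hτ' : ∀ s, HasDerivAt (deriv τ) (-(surfaceGravity g i ξ (γ (τ s)) * deriv τ s ^ 2)) s) :
    g.IsGeodesicOn (i ∘ γ ∘ τ) univ := by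
  refine ⟨(hL.contMDiff.comp ((hγ.contMDiff hξ.contMDiff).comp
    hτ.contMDiff)).contMDiffOn, fun s _ ↦ ?_⟩
  have hvel : (velocity (E := E) (i ∘ γ ∘ τ) : ℝ → E) =
      fun s ↦ deriv τ s • pushLinear E E' i (γ (τ s)) (ξ (γ (τ s))) :=
    funext fun s ↦ hL.velocity_reparam hγ hτ s
  have hWd := ((hL.contDiffAt_push_integralCurve hξ hξ hγ
    (τ s)).differentiableAt (by simp)).hasDerivAt
  have h1 := g.covDerivAlong_reparam (τ := τ) (s := s) (c := i ∘ γ)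
    (W := fun s ↦ pushLinear E E' i (γ s) (ξ (γ s)))
    (hL.hasMFDerivAt_comp_integralCurve hγ (τ s)) hWd
    ((hτ.differentiable (by simp)) s).hasDerivAt (hτ' s)
    (hL.covDerivAlong_velocity_integralCurve hξ hγ (τ s))
  refine (congrArg (fun V : ℝ → E ↦ (g.covDerivAlong (E' := ℝ) (i ∘ γ ∘ τ) V s (1 : ℝ) : E))
    hvel).trans (h1.trans ?_)
  have hzero (k d : ℝ) (w : E) : -(k * d ^ 2) • w + (d * d) • k • w = 0 := by module
  exact hzero _ _ _

end IsNullHypersurface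

end Generators

/-! ### Complete generators and infinite affine lengths. -/

section Completeness

variable {E : Type*} [NormedAddCommGroup E] [NormedSpace ℝ E] [FiniteDimensional ℝ E]
  {M : Type*} [TopologicalSpace M] [ChartedSpace E M] [IsManifold 𝓘(ℝ, E) ∞ M]
  {g : SpacetimeStructure E M}
  {E' : Type*} [NormedAddCommGroup E'] [NormedSpace ℝ E']
  {L : Type*} [TopologicalSpace L] [ChartedSpace E' L] [IsManifold 𝓘(ℝ, E') ∞ L]
  {i : L → M} {ξ : L → E'} {γ : ℝ → L}

namespace IsNullHypersurface

theorem mem_affineDomain (hL : IsNullHypersurface (E' := E') g i)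
    (hξ : IsNullSection g i ξ) (hγ : IsMIntegralCurve γ (I := 𝓘(ℝ, E')) ξ) {τ : ℝ → ℝ}
    (hτ : ContDiff ℝ ∞ τ) (hτ0 : τ 0 = 0) (hτ1 : deriv τ 0 = 1)
    (hτ' : ∀ s, HasDerivAt (deriv τ) (-(surfaceGravity g i ξ (γ (τ s)) * deriv τ s ^ 2)) s)
    (s : ℝ) : (γ 0, s) ∈ affineDomain g i ξ := by
  -- `exp (s ξ)` is the value at time `1` of the geodesic with initial velocity `s ξ`. The equation
  -- for `τ` is invariant under `r ↦ s r`, as both sides scale by `s²`, so every real `s`, zero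
  -- included, is covered.
  set σ : ℝ → ℝ := fun r ↦ τ (s * r) with hσ
  have hσc : ContDiff ℝ ∞ σ := hτ.comp (contDiff_const.mul contDiff_id)
  have hmul (r : ℝ) : HasDerivAt (fun r ↦ s * r) s r := by
    simpa using (hasDerivAt_id r).const_mul s
  have hσd : deriv σ = fun r ↦ deriv τ (s * r) * s := funext fun r ↦
    (((hτ.differentiable (by simp)) (s * r)).hasDerivAt.comp r (hmul r)).deriv
  have hσ' (r : ℝ) :
      HasDerivAt (deriv σ) (-(surfaceGravity g i ξ (γ (σ r)) * deriv σ r ^ 2)) r := by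
    rw [hσd]
    refine (((hτ' (s * r)).comp r (hmul r)).mul_const s).congr_deriv ?_
    simp only [hσ]
    ring
  have hσ0 : σ 0 = 0 := by simp [hσ, hτ0]
  have hσ1 : deriv σ 0 = s := by simp [hσd, hτ1]
  refine ⟨γ (τ s), i ∘ γ ∘ σ, univ, isOpen_univ, ordConnected_univ, subset_univ _,
    hL.isGeodesicOn_reparam hξ hγ hσc hσ', ?_, ?_⟩
  · refine (congrArg (TotalSpace.mk (F := E) ((i ∘ γ ∘ σ) 0))
      (hL.velocity_reparam hγ hσc 0)).trans ?_
    change (⟨i (γ (σ 0)), (deriv σ 0 • pushLinear E E' i (γ (σ 0)) (ξ (γ (σ 0))) : E)⟩ :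
      TangentBundle 𝓘(ℝ, E) M) = _
    rw [hσ1, hσ0]
    rfl
  · simp [hσ]

theorem hasCompleteNullGenerator (hL : IsNullHypersurface (E' := E') g i)
    (hξ : IsNullSection g i ξ) (hγ : IsMIntegralCurve γ (I := 𝓘(ℝ, E')) ξ) {τ : ℝ → ℝ}
    (hτ : ContDiff ℝ ∞ τ) (hτ0 : τ 0 = 0) (hτpos : ∀ s, 0 < deriv τ s)
    (hτ' : ∀ s, HasDerivAt (deriv τ) (-(surfaceGravity g i ξ (γ (τ s)) * deriv τ s ^ 2)) s) :
    HasCompleteNullGenerator E' g i (γ 0) := by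
  refine ⟨γ ∘ τ, (hγ.contMDiff hξ.contMDiff).comp hτ.contMDiff, congrArg γ hτ0,
    hL.isGeodesicOn_reparam hξ hγ hτ hτ', fun t ↦ ?_⟩
  have hv := hL.velocity_reparam hγ hτ t
  constructor
  · exact fun h ↦ smul_ne_zero (hτpos t).ne' (hL.pushLinear_ne_zero hξ (γ (τ t)))
      (hv.symm.trans h)
  · refine (congrArg (fun w : E ↦ g.form (i (γ (τ t))) w w) hv).trans ?_
    rw [map_smul, map_smul, smul_apply, hL.form_push_eq_zero hξ]
    simp

end IsNullHypersurface

omit [IsManifold 𝓘(ℝ, E') ∞ L] in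
theorem futureAffineLength_eq_top {x : L}
    (h : ∀ s : ℝ, (x, s) ∈ affineDomain g i ξ) : futureAffineLength g i ξ x = ⊤ := by
  refine EReal.eq_top_iff_forall_lt _ |>.2 fun y ↦ ?_
  have h1 : (y : EReal) < ((|y| + 1 : ℝ) : EReal) :=
    EReal.coe_lt_coe_iff.2 (by linarith [le_abs_self y])
  refine h1.trans_le (le_sSup ⟨|y| + 1, by positivity, ?_, rfl⟩)
  rintro ⟨x', s⟩ ⟨rfl, -⟩
  exact h s

omit [IsManifold 𝓘(ℝ, E') ∞ L] in
theorem pastAffineLength_eq_bot {x : L}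
    (h : ∀ s : ℝ, (x, s) ∈ affineDomain g i ξ) : pastAffineLength g i ξ x = ⊥ := by
  refine EReal.eq_bot_iff_forall_lt _ |>.2 fun y ↦ ?_
  have h1 : ((-(|y| + 1) : ℝ) : EReal) < y :=
    EReal.coe_lt_coe_iff.2 (by linarith [neg_abs_le y])
  refine lt_of_le_of_lt (sInf_le ⟨-(|y| + 1), by linarith [abs_nonneg y], ?_, rfl⟩) h1
  rintro ⟨x', s⟩ ⟨rfl, -⟩
  exact h s

end Completeness

theorem mainTheorem6
    {E : Type*} [NormedAddCommGroup E] [NormedSpace ℝ E] [FiniteDimensional ℝ E]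
    (hdim : 3 ≤ Module.finrank ℝ E)
    {M : Type*} [TopologicalSpace M] [T2Space M] [SecondCountableTopology M] [ConnectedSpace M]
    [ChartedSpace E M] [IsManifold 𝓘(ℝ, E) ∞ M]
    (g : SpacetimeStructure E M)
    {E' : Type*} [NormedAddCommGroup E'] [NormedSpace ℝ E'] [FiniteDimensional ℝ E']
    {L : Type*} [TopologicalSpace L] [ChartedSpace E' L] [IsManifold 𝓘(ℝ, E') ∞ L]
    (i : L → M) (hL : IsNullHypersurface (E' := E') g i)
    (ξ : (x : L) → TangentSpace 𝓘(ℝ, E') x) (hξ : IsNullSection g i ξ)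
    (x₀ : L) (γ : ℝ → L) (hγ₀ : γ 0 = x₀)
    (hγ : IsMIntegralCurveOn γ ξ {t : ℝ | initialParameter ξ x₀ < t ∧ t < finalParameter ξ x₀})
    (hb_final : finalParameter ξ x₀ = ⊤) (hb_initial : initialParameter ξ x₀ = ⊥)
    (hκ_nonneg : ∀ t : ℝ, 0 ≤ t → 0 ≤ surfaceGravity g i ξ (γ t))
    (hκ_nonpos : ∀ t : ℝ, t ≤ 0 → surfaceGravity g i ξ (γ t) ≤ 0) :
    (¬ ∃ η : (x : L) → TangentSpace 𝓘(ℝ, E') x, IsNullSection g i η ∧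
      ∃ c : ℝ, c ≠ 0 ∧ ∀ x : L, surfaceGravity g i η x = c) ∧
    HasCompleteNullGenerator E' g i x₀ ∧
    futureAffineLength g i ξ x₀ = ⊤ ∧ pastAffineLength g i ξ x₀ = ⊥ := by
  -- With infinite endpoints the maximal interval is the whole line.
  have hγ' : IsMIntegralCurve γ (I := 𝓘(ℝ, E')) ξ := by
    rw [isMIntegralCurve_iff_isMIntegralCurveOn]
    convert hγ
    simp [hb_initial, hb_final]
  subst hγ₀
  obtain ⟨τ, hτ, hτ0, hτ1, hτpos, hτ'⟩ := exists_affine_parameter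
    (hL.contDiff_surfaceGravity hξ hγ') hκ_nonneg hκ_nonpos
  have hmem := hL.mem_affineDomain hξ hγ' hτ hτ0 hτ1 hτ'
  refine ⟨?_, hL.hasCompleteNullGenerator hξ hγ' hτ hτ0 hτpos hτ',
    futureAffineLength_eq_top hmem, pastAffineLength_eq_bot hmem⟩
  rintro ⟨η, hη, c, hc, hηc⟩
  exact hL.surfaceGravity_not_const hξ hγ' hκ_nonneg hκ_nonpos hη hc hηc
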